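/- Let $G$ be a (finite-dimensional, real) Lie group with Lie algebra $\mathfrak g$, and let $\lambda(g,x)=g\cdot x$ be a smooth linear action of $G$ on $\mathbb R^n$. Its leaves are the group orbits $G\cdot x$. Let $X=X_{\rm tan}+X_{\rm inv}$, where $X_{\rm tan}$ is a smooth vector field on $\mathbb R^n$ tangent to the leaves and $X_{\rm inv}$ is a smooth $G$-invariant vector field, $X_{\rm inv}(g\cdot x)=g\cdot X_{\rm inv}(x)$. Choose a smooth map $A:G\times\mathbb R^n\to\mathfrak g$ with $$D_1\lambda(g,m)\bigl(A(g,m)\,g\bigr)=X_{\rm tan}(g\cdot m)\qquad(g\in G,\ m\in\mathbb R^n),$$ where $A(g,m)\,g\in T_gG$ denotes the right translate of $A(g,m)$; that is, choose a differential equation $\dot g=A(g,m)\,g$ on $G$ so that $x=g\cdot m$ solves $\dot x=X(x)$ when $\dot m=X_{\rm inv}(m)$. Let $(a_{ij}),(b_i)$ be the coefficients of an $s$-stage Runge–Kutta method (explicit or implicit) of order $p$, and let $r\in\{0,1,2,\dots\}\cup\{\infty\}$ with $r\ge p-2$. Put $\operatorname{dexp}^{-1}_u(v)=\sum_{j=0}^{r}\frac{B_j}{j!}\operatorname{ad}_u^j(v)$,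 with the Bernoulli numbers $B_j$ ($B_1=-\tfrac12$). Define the one-step method $x\mapsto x'$ with step size $\tau$ as follows. (i) Apply the Runge–Kutta method to $\dot m=X_{\rm inv}(m)$, $m(0)=x$: $$M_i=x+\tau\sum_j a_{ij}X_{\rm inv}(M_j),\qquad m_1=x+\tau\sum_i b_iX_{\rm inv}(M_i).$$ (ii) Apply the associated Runge–Kutta–Munthe-Kaas method to $\dot g=A(g,m)\,g$, $g(0)=1$, with the stage values $M_j$ for $m$: $$U_i=\tau\sum_j a_{ij}k_j,\qquad k_j=\operatorname{dexp}^{-1}_{U_j}\bigl(A(\exp U_j,M_j)\bigr),\qquad g_1=\exp\Bigl(\tau\sum_i b_ik_i\Bigr).$$ (iii) Put $x'=g_1\cdot m_1$. Here the stage values are those obtained by following the solutions of the stage equations continuously from step size $0$ to step size $\tau$, where the linearized stage equations for $M$ are required to stay nondegenerate, and the series $k_j$ to converge (for an explicit method with finite $r$ these are the values given by the usual recursion, for every $\tau$). A one-step method is an integrator of order $p$ for a vector field $X$ if every $x_0$ has a constant $C$ such that, for all sufficiently small $\tau$ and all $x$ sufficiently near $x_0$, the step is defined and its result differs by at most $C|\tau|^{p+1}$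 from the value at time $\tau$ of the solution of $\dot y=X(y)$, $y(0)=x$. A Runge–Kutta method has order $p$ if this holds for every smooth vector field on every $\mathbb R^N$. Then the method $x\mapsto x'$ is a foliate integrator of order $p$ for $X$. That is, it is an integrator of order $p$ for $X$, and for every step size $\tau$ it maps leaves to leaves: if $x$ and $y$ lie on the same leaf and the steps of size $\tau$ from $x$ and from $y$ are defined, with results $x'$ and $y'$, then $x'$ and $y'$ lie on the same leaf. Moreover, if for some $\tau$ both the step $x\mapsto m_1$ and the step $x\mapsto x'$ are defined on all of $\mathbb R^n$, the first is injective and the second is surjective (for instance, if both are diffeomorphisms of $\mathbb R^n$), then $x\mapsto x'$ maps each leaf onto a leaf. -/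

import Mathlib

open scoped Manifold ContDiff Topology

noncomputable section

/-! ### One-step methods and their order -/

/-- A one-step method is a (partially defined) relation `step τ x x'`: from `x`, the step of size `τ`
leads to `x'`.  It is an integrator of order `p` for the vector field `X` if, locally uniformly in the
initial value, for small `τ` the step is defined and its result differs from the value at time `τ`
of the exact solution by at most `C |τ| ^ (p + 1)`. -/
def IsIntegratorOfOrder {V : Type*} [NormedAddCommGroup V] [NormedSpace ℝ V]
    (p : ℕ) (step : ℝ → V → V → Prop) (X : V → V) : Prop :=
  ∀ x₀ : V, ∃ C : ℝ, ∀ᶠ q : ℝ × V in 𝓝 ((0 : ℝ), x₀),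
    (∃ x' : V, step q.1 q.2 x') ∧
    ∀ x' : V, step q.1 q.2 x' →
      ∀ y : ℝ → V, y 0 = q.2 →
        (∀ t ∈ Set.uIcc 0 q.1, HasDerivWithinAt y (X (y t)) (Set.uIcc 0 q.1) t) →
        ‖x' - y q.1‖ ≤ C * |q.1| ^ (p + 1)

/-! ### Runge-Kutta methods -/

/-- The coefficients of a Runge-Kutta method (explicit or implicit) with `s` stages. -/
structure ButcherTableau (s : ℕ) where
  a : Matrix (Fin s) (Fin s) ℝ
  b : Fin s → ℝ

namespace ButcherTableau

variable {s : ℕ} {V : Type*} [NormedAddCommGroup V] [NormedSpace ℝ V]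

/-- `Y` satisfies the stage equations `Y i = x + τ ∑ j, a i j • f (Y j)`. -/
def StageEq (T : ButcherTableau s) (f : V → V) (τ : ℝ) (x : V) (Y : Fin s → V) : Prop :=
  ∀ i, Y i = x + τ • ∑ j, T.a i j • f (Y j)

/-- The linearization of the stage equations at `Y` is nondegenerate. For an explicit method this
holds for all `τ` and all `Y`. -/
def StageRegular (T : ButcherTableau s) (f : V → V) (τ : ℝ) (Y : Fin s → V) : Prop :=
  ∀ Z : Fin s → V, (∀ i, Z i = τ • ∑ j, T.a i j • fderiv ℝ f (Y j) (Z j)) → Z = 0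

/-- The stage values of the method, followed continuously from step size `0` (where they all equal
`x`, by the stage equations) to step size `τ`.  For an explicit method the stage values are given
by the usual recursion, for every `τ`; for an implicit method this singles out the solution of the
stage equations that belongs to the method. -/
def StageBranch (T : ButcherTableau s) (f : V → V) (τ : ℝ) (x : V) (Y : ℝ → Fin s → V) : Prop :=
  ContinuousOn Y (Set.uIcc 0 τ) ∧
    ∀ σ ∈ Set.uIcc 0 τ, T.StageEq f σ x (Y σ) ∧ T.StageRegular f σ (Y σ)

/-- The result `x + τ ∑ i, b i • f (Y i)` of a step with stage values `Y`. -/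
def update (T : ButcherTableau s) (f : V → V) (τ : ℝ) (x : V) (Y : Fin s → V) : V :=
  x + τ • ∑ i, T.b i • f (Y i)

/-- The Runge-Kutta step of size `τ` for `ẋ = f x`. -/
def Step (T : ButcherTableau s) (f : V → V) (τ : ℝ) (x x' : V) : Prop :=
  ∃ Y : ℝ → Fin s → V, T.StageBranch f τ x Y ∧ x' = T.update f τ x (Y τ)

/-- A Runge-Kutta method has order `p` if it is an integrator of order `p` for every smooth vector
field on every `ℝ ^ N`. -/
def HasOrder (T : ButcherTableau s) (p : ℕ) : Prop :=
  ∀ (N : ℕ) (f : EuclideanSpace ℝ (Fin N) → EuclideanSpace ℝ (Fin N)), ContDiff ℝ ∞ f →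
    IsIntegratorOfOrder p (T.Step f) f

end ButcherTableau

/-! ### Lie groups: exponential map, inverse of its trivialized differential -/

section LieGroupTools

variable {E : Type*} [NormedAddCommGroup E] [NormedSpace ℝ E]
  {G : Type*} [TopologicalSpace G] [ChartedSpace E G] [Group G]

/-- The exponential map: `lieExp ξ` is the value at time `1` of the integral curve through `1` of
the left-invariant vector field defined by `ξ`. -/
def lieExp (ξ : GroupLieAlgebra 𝓘(ℝ, E) G) : G :=
  Classical.epsilon fun g : G => ∃ γ : ℝ → G,
    γ 0 = 1 ∧ IsMIntegralCurve (I := 𝓘(ℝ, E)) γ (mulInvariantVectorField ξ) ∧ γ 1 = g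

/-- The image `ξ g ∈ T_g G` of `ξ` under the derivative at `1` of the right multiplication
by `g`. -/
def rightTranslate (ξ : GroupLieAlgebra 𝓘(ℝ, E) G) (g : G) : TangentSpace 𝓘(ℝ, E) (1 * g) :=
  mfderiv 𝓘(ℝ, E) 𝓘(ℝ, E) (fun h : G => h * g) (1 : G) ξ

/-- The `j`-th term `(B_j / j!) ad_u ^ j (v)` of the series of `dexp⁻¹_u (v)`, where `B_j` are the
Bernoulli numbers (`B_1 = -1/2`), put equal to `0` for `j > r`. -/
def dexpInvTerm (r : ℕ∞) (u v : GroupLieAlgebra 𝓘(ℝ, E) G) (j : ℕ) : GroupLieAlgebra 𝓘(ℝ, E) G :=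
  open Classical in
  if (j : ℕ∞) ≤ r then
    (((bernoulli j : ℚ) : ℝ) / (j.factorial : ℝ)) •
      (fun w : GroupLieAlgebra 𝓘(ℝ, E) G => ⁅u, w⁆)^[j] v
  else 0

/-- `dexp⁻¹_u (v) = v - [u, v] / 2 + [u, [u, v]] / 12 - ⋯`, truncated at index `r`
(not truncated if `r = ⊤`). -/
def dexpInv (r : ℕ∞) (u v : GroupLieAlgebra 𝓘(ℝ, E) G) : GroupLieAlgebra 𝓘(ℝ, E) G :=
  ∑' j : ℕ, dexpInvTerm r u v j

end LieGroupTools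

/-! ### Linear actions, and the combined Runge-Kutta / Runge-Kutta-Munthe-Kaas step -/

section Foliate

variable {E : Type*} [NormedAddCommGroup E] [NormedSpace ℝ E]
  {G : Type*} [TopologicalSpace G] [ChartedSpace E G] [Group G]
  {V : Type*} [NormedAddCommGroup V] [NormedSpace ℝ V]
  {s : ℕ}

/-- The leaf through `x` of the foliation defined by a linear action: the group orbit of `x`. -/
def leaf (ρ : Representation ℝ G V) (x : V) : Set V := Set.range fun g : G => ρ g x

/-- `D₁λ(g, m) : T_g G → V`, the derivative of the action `λ(g, m) = ρ g m` in its first slot. -/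
def actionDeriv (ρ : Representation ℝ G V) (g : G) (m : V) : TangentSpace 𝓘(ℝ, E) g →L[ℝ] V :=
  mfderiv 𝓘(ℝ, E) 𝓘(ℝ, V) (fun h : G => ρ h m) g

/-- The vector field `X` is tangent to the leaves: `X x = ξ_V x` for some `ξ` in the Lie algebra,
for every `x`. -/
def IsTangentToLeaves (ρ : Representation ℝ G V) (X : V → V) : Prop :=
  ∀ x, ∃ ξ : GroupLieAlgebra 𝓘(ℝ, E) G, X x = actionDeriv (E := E) ρ 1 x ξ

/-- The stage values `U` of the Munthe-Kaas method for `ġ = A(g, m) g`, `g = 1` at the beginning of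
the step, at step size `τ` and with stage values `M` for `m`: with `g j = exp (U j)` and
`k j = dexp⁻¹_(U j) (A(g j, M j))`, one has `U i = τ ∑ j, a i j • k j`. -/
def MKStageEq (T : ButcherTableau s) (r : ℕ∞) (A : G → V → GroupLieAlgebra 𝓘(ℝ, E) G)
    (τ : ℝ) (M : Fin s → V) (U : Fin s → GroupLieAlgebra 𝓘(ℝ, E) G) : Prop :=
  (∀ j, Summable (dexpInvTerm r (U j) (A (lieExp (U j)) (M j)))) ∧
    ∀ i, U i = τ • ∑ j, T.a i j • dexpInv r (U j) (A (lieExp (U j)) (M j))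

/-- The Munthe-Kaas stage values, followed continuously from step size `0` to step size `τ`. -/
def MKStageBranch (T : ButcherTableau s) (r : ℕ∞) (A : G → V → GroupLieAlgebra 𝓘(ℝ, E) G)
    (τ : ℝ) (M : ℝ → Fin s → V) (U : ℝ → Fin s → GroupLieAlgebra 𝓘(ℝ, E) G) : Prop :=
  ContinuousOn U (Set.uIcc 0 τ) ∧ ∀ σ ∈ Set.uIcc 0 τ, MKStageEq T r A σ (M σ) (U σ)

/-- The result `exp (τ ∑ i, b i • k i)` on `G` of the Munthe-Kaas step. -/
def mkUpdate (T : ButcherTableau s) (r : ℕ∞) (A : G → V → GroupLieAlgebra 𝓘(ℝ, E) G)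
    (τ : ℝ) (M : Fin s → V) (U : Fin s → GroupLieAlgebra 𝓘(ℝ, E) G) : G :=
  lieExp (τ • ∑ i, T.b i • dexpInv r (U i) (A (lieExp (U i)) (M i)))

/-- The combined step of size `τ` from `x` to `x' = g₁ · m₁`: the Runge-Kutta method for
`ṁ = Y m`, `m(0) = x`, gives `m₁`, and the associated Munthe-Kaas method (with `dexp⁻¹` truncated
at index `r`) for `ġ = A(g, m) g`, `g(0) = 1`, with the Runge-Kutta stage values for `m`,
gives `g₁`. -/
def CombinedStep (ρ : Representation ℝ G V) (T : ButcherTableau s) (r : ℕ∞)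
    (A : G → V → GroupLieAlgebra 𝓘(ℝ, E) G) (Y : V → V) (τ : ℝ) (x x' : V) : Prop :=
  ∃ (M : ℝ → Fin s → V) (U : ℝ → Fin s → GroupLieAlgebra 𝓘(ℝ, E) G),
    T.StageBranch Y τ x M ∧ MKStageBranch T r A τ M U ∧
    x' = ρ (mkUpdate T r A τ (M τ) (U τ)) (T.update Y τ x (M τ))

end Foliate

end

/-!
The statement has an analytic part (order `p`) and a geometric part (leaves go to leaves).

*Leaves.* The vector field `Xinv` commutes with the linear maps `ρ g`, and Runge-Kutta methods
commute with linear changes of variables. The stage values, followed continuously from step size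
`0`, are unique (`ButcherTableau.StageBranch.eqOn`: nondegeneracy gives local uniqueness, and a
clopen argument does the rest). So the Runge-Kutta step `x ↦ m₁` commutes with the action. The
combined step moves `m₁` by a group element, hence within its leaf
(`CombinedStep.mem_leaf`, `image_leaf_of_surjective`).

*Order.* The Lie group is removed first. Let `σ` be the derivative at `1` of the action, a
representation of the Lie algebra by matrices (`repDeriv_modelBracket`). Then `ρ (exp u) = exp (σ u)`
(`repCLM_lieExp`), the condition on `A` reads `σ (A (g, m)) (g · m) = Xtan (g · m)`
(`actionDeriv_rightTranslate`), and `u ↦ A (exp u, m)` is smooth near `u = 0`, because the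
exponential map is (`exists_contMDiffOn_lieExp`). Smoothness of `exp` is smooth dependence of
solutions on a parameter, obtained from the inverse function theorem for the Picard map in a space
of continuous curves (`exists_solution_contDiffOn`).

What remains is a statement about vector spaces, `isIntegratorOfOrder_algebraStep`. For small steps
the stage equations of the combined method are those of the Runge-Kutta method for the system
`u' = dexp⁻¹_u (A (exp u, m))`, `m' = Xinv m`, started at `(0, x)` (`eventually_stageBranch_iff`);
the combined step is the image of the Runge-Kutta step under `(u, m) ↦ exp (σ u) m`. This map is
locally Lipschitz, so it is enough that it carries the exact flow of the system to the flow of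
`Xtan + Xinv` up to `O(τ ^ (p + 1))` (`exists_flow_estimate`). With the full Bernoulli series it does
so exactly, since the series inverts the trivialized differential of `exp` (`fderiv_exp_bernoulli`).
If the series is cut off after the index `r`, the first omitted term is `O(τ ^ (r + 2))` rather than
`O(τ ^ (r + 1))`: along the flow `u = τ v + O(τ ^ 2)` with `v = A (exp u, m)`, so the innermost
bracket `[u, v]` is `O(τ ^ 2)`. Hence `r ≥ p - 2` suffices, by Grönwall's inequality.
-/

noncomputable section

/-! ### Runge-Kutta methods: changes of variables, uniqueness of stage values, small steps -/

namespace ButcherTableau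

section Equivariance

variable {s : ℕ} {V V' : Type*} [NormedAddCommGroup V] [NormedSpace ℝ V]
  [NormedAddCommGroup V'] [NormedSpace ℝ V']

/-- Runge-Kutta stage branches commute with linear changes of variables. -/
theorem StageBranch.map {T : ButcherTableau s} {f : V → V} {f' : V' → V'} (L : V ≃L[ℝ] V')
    (h : ∀ x, f' (L x) = L (f x)) {τ : ℝ} {x : V} {Y : ℝ → Fin s → V}
    (hY : T.StageBranch f τ x Y) : T.StageBranch f' τ (L x) (fun σ i => L (Y σ i)) := by
  have hf' : f' = L ∘ f ∘ L.symm := by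
    funext y
    simpa using h (L.symm y)
  refine ⟨?_, fun σ hσ => ⟨fun i => ?_, fun Z hZ => ?_⟩⟩
  · exact continuousOn_pi.2 fun i =>
      L.continuous.comp_continuousOn ((continuousOn_pi.1 hY.1) i)
  · have := (hY.2 σ hσ).1 i
    simp only [h]
    rw [this]
    simp [map_sum]
  · have hreg := (hY.2 σ hσ).2 (fun i => L.symm (Z i)) fun i => by
      have hder : ∀ (y : V) (v : V'), fderiv ℝ f' (L y) v = L (fderiv ℝ f y (L.symm v)) := by
        intro y v
        rw [hf', L.comp_fderiv, L.symm.comp_right_fderiv]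
        simp
      have := hZ i
      simp only [hder] at this
      change L.symm (Z i) = _
      rw [this]
      simp [map_sum]
    funext i
    simpa using congrFun hreg i

/-- Runge-Kutta steps commute with linear changes of variables. -/
theorem Step.map {T : ButcherTableau s} {f : V → V} {f' : V' → V'} (L : V ≃L[ℝ] V')
    (h : ∀ x, f' (L x) = L (f x)) {τ : ℝ} {x x' : V}
    (hx : T.Step f τ x x') : T.Step f' τ (L x) (L x') := by
  obtain ⟨Y, hY, rfl⟩ := hx
  refine ⟨_, hY.map L h, ?_⟩
  simp [update, map_sum, h]

/-- The order of a Runge-Kutta method is attained for smooth vector fields on arbitrary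
finite-dimensional normed spaces. -/
theorem HasOrder.isIntegratorOfOrder {W : Type*} [NormedAddCommGroup W] [NormedSpace ℝ W]
    [FiniteDimensional ℝ W] {T : ButcherTableau s} {p : ℕ} (hT : T.HasOrder p) {f : W → W}
    (hf : ContDiff ℝ ∞ f) : IsIntegratorOfOrder p (T.Step f) f := by
  obtain ⟨L⟩ : Nonempty (W ≃L[ℝ] EuclideanSpace ℝ (Fin (Module.finrank ℝ W))) :=
    ⟨ContinuousLinearEquiv.ofFinrankEq (by simp)⟩
  intro x₀
  set f' : EuclideanSpace ℝ (Fin (Module.finrank ℝ W)) → _ := fun y => L (f (L.symm y)) with hf'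
  have hfL : ∀ x, f' (L x) = L (f x) := fun x => by simp [hf']
  have hfL' : ∀ x, f (L.symm x) = L.symm (f' x) := fun x => by simp [hf']
  obtain ⟨C, hC⟩ := hT _ f' (L.contDiff.comp (hf.comp L.symm.contDiff)) (L x₀)
  set L' : EuclideanSpace ℝ (Fin (Module.finrank ℝ W)) →L[ℝ] W :=
    L.symm.toContinuousLinearMap with hL'
  refine ⟨‖L'‖ * C, ?_⟩
  have hcont : Filter.Tendsto (fun q : ℝ × W => (q.1, L q.2)) (𝓝 (0, x₀)) (𝓝 (0, L x₀)) :=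
    (continuous_fst.prodMk (L.continuous.comp continuous_snd)).tendsto' _ _ rfl
  filter_upwards [hcont.eventually hC] with q hq
  obtain ⟨⟨x', hx'⟩, herr⟩ := hq
  refine ⟨⟨L.symm x', by simpa using hx'.map L.symm hfL'⟩, fun x' hx' y hy0 hy => ?_⟩
  have := herr (L x') (hx'.map L hfL) (fun t => L (y t)) (by simp [hy0]) fun t ht => by
    rw [hfL]
    exact L.toContinuousLinearMap.hasFDerivAt.comp_hasDerivWithinAt t (hy t ht)
  calc ‖x' - y q.1‖ = ‖L' (L x' - L (y q.1))‖ := by simp [hL']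
    _ ≤ ‖L'‖ * ‖L x' - L (y q.1)‖ := ContinuousLinearMap.le_opNorm _ _
    _ ≤ ‖L'‖ * (C * |q.1| ^ (p + 1)) := by gcongr
    _ = _ := by ring

end Equivariance

section Uniqueness

variable {s : ℕ} {V : Type*} [NormedAddCommGroup V] [NormedSpace ℝ V]

theorem StageBranch.zero {T : ButcherTableau s} {f : V → V} {τ : ℝ} {x : V} {Y : ℝ → Fin s → V}
    (hY : T.StageBranch f τ x Y) : Y 0 = fun _ => x := by
  funext i
  simpa using (hY.2 0 Set.left_mem_uIcc).1 i

/-- The defect `Y - x - σ A f(Y)` of the stage equations. -/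
def stageDefect (T : ButcherTableau s) (f : V → V) (x : V) (q : ℝ × (Fin s → V)) : Fin s → V :=
  fun i => q.2 i - x - q.1 • ∑ j, T.a i j • f (q.2 j)

theorem contDiff_stageDefect (T : ButcherTableau s) {f : V → V} (hf : ContDiff ℝ 1 f) (x : V) :
    ContDiff ℝ 1 (T.stageDefect f x) := by
  unfold stageDefect
  fun_prop

theorem fderiv_stageDefect (T : ButcherTableau s) {f : V → V} (hf : ContDiff ℝ 1 f) (x : V)
    (σ : ℝ) (Y Z : Fin s → V) (i : Fin s) :
    fderiv ℝ (T.stageDefect f x) (σ, Y) (0, Z) i =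
      Z i - σ • ∑ j, T.a i j • fderiv ℝ f (Y j) (Z j) := by
  have hd : Differentiable ℝ f := hf.differentiable one_ne_zero
  have h1 : HasDerivAt (fun t : ℝ => T.stageDefect f x (σ, Y + t • Z))
      (fderiv ℝ (T.stageDefect f x) (σ, Y) (0, Z)) 0 := by
    have hg : HasFDerivAt (T.stageDefect f x) (fderiv ℝ (T.stageDefect f x) (σ, Y))
        (σ, Y + (0 : ℝ) • Z) := by
      simpa using ((T.contDiff_stageDefect hf x).differentiable one_ne_zero (σ, Y)).hasFDerivAt
    refine hg.comp_hasDerivAt (0 : ℝ) (f := fun t : ℝ => (σ, Y + t • Z)) ?_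
    refine (hasDerivAt_const _ _).prodMk ?_
    simpa using ((hasDerivAt_id (0 : ℝ)).smul_const Z).const_add Y
  have h2 := hasDerivAt_pi.1 h1 i
  refine h2.unique ?_
  have hline : ∀ j, HasDerivAt (fun t : ℝ => Y j + t • Z j) (Z j) 0 := fun j => by
    simpa using ((hasDerivAt_id (0 : ℝ)).smul_const (Z j)).const_add (Y j)
  have hf' : ∀ j, HasDerivAt (fun t : ℝ => f (Y j + t • Z j)) (fderiv ℝ f (Y j) (Z j)) 0 :=
    fun j => by
      have hg : HasFDerivAt f (fderiv ℝ f (Y j)) (Y j + (0 : ℝ) • Z j) := by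
        simpa using (hd (Y j)).hasFDerivAt
      exact hg.comp_hasDerivAt (0 : ℝ) (hline j)
  have hsum := HasDerivAt.fun_sum (u := Finset.univ) fun j _ => (hf' j).const_smul (T.a i j)
  exact (((hline i).sub_const x).sub (hsum.const_smul σ))

/-- Near a nondegenerate solution of the stage equations, the solutions are locally unique,
also for nearby step sizes. -/
theorem eventually_stageEq_unique [FiniteDimensional ℝ V] (T : ButcherTableau s) {f : V → V}
    (hf : ContDiff ℝ 1 f) (x : V) {σ : ℝ} {Y : Fin s → V} (hreg : T.StageRegular f σ Y) :
    ∀ᶠ q : (ℝ × (Fin s → V)) × (ℝ × (Fin s → V)) in 𝓝 ((σ, Y), (σ, Y)),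
      q.1.1 = q.2.1 → T.StageEq f q.1.1 x q.1.2 → T.StageEq f q.2.1 x q.2.2 → q.1.2 = q.2.2 := by
  set D := fderiv ℝ (T.stageDefect f x) (σ, Y)
  have hstrict : HasStrictFDerivAt (T.stageDefect f x) D (σ, Y) :=
    (T.contDiff_stageDefect hf x).contDiffAt.hasStrictFDerivAt one_ne_zero
  -- the derivative in the stages is injective, hence bounded below; strict differentiability
  -- transfers this to the difference of two zeros of the defect
  set D₂ : (Fin s → V) →L[ℝ] (Fin s → V) := D.comp (ContinuousLinearMap.inr ℝ ℝ _) with hD₂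
  have hker : LinearMap.ker (D₂ : (Fin s → V) →ₗ[ℝ] (Fin s → V)) = ⊥ := by
    refine LinearMap.ker_eq_bot'.2 fun Z hZ => hreg Z fun i => ?_
    have := T.fderiv_stageDefect hf x σ Y Z i
    have hz : D (0, Z) = 0 := hZ
    rw [show fderiv ℝ (T.stageDefect f x) (σ, Y) (0, Z) = 0 from hz] at this
    simpa [sub_eq_zero] using this.symm
  obtain ⟨K, hK, hanti⟩ := LinearMap.exists_antilipschitzWith _ hker
  have hlittle := hstrict.isLittleO.def (c := (2 * (K : ℝ))⁻¹) (by positivity)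
  have hzero : ∀ (σ : ℝ) (Y : Fin s → V), T.StageEq f σ x Y → T.stageDefect f x (σ, Y) = 0 := by
    intro σ Y h
    funext i
    simp only [stageDefect, Pi.zero_apply]
    rw [sub_eq_zero, sub_eq_iff_eq_add', ← h i]
  filter_upwards [hlittle] with q hq h1 h2 h3
  rw [hzero _ _ h2, hzero _ _ h3] at hq
  have hsub : q.1 - q.2 = (0, q.1.2 - q.2.2) := by
    ext1 <;> simp [h1]
  rw [hsub] at hq
  have h4 : ‖q.1.2 - q.2.2‖ ≤ K * ‖D (0, q.1.2 - q.2.2)‖ := by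
    have := hanti.le_mul_dist (q.1.2 - q.2.2) 0
    rw [dist_zero_right, map_zero, dist_zero_right] at this
    exact this
  have h5 : ‖((0 : ℝ), q.1.2 - q.2.2)‖ = ‖q.1.2 - q.2.2‖ := by simp [Prod.norm_def]
  rw [h5] at hq
  simp only [sub_self, zero_sub, norm_neg] at hq
  have h6 : ‖q.1.2 - q.2.2‖ ≤ ‖q.1.2 - q.2.2‖ / 2 := by
    calc _ ≤ K * ‖D (0, q.1.2 - q.2.2)‖ := h4
      _ ≤ K * ((2 * (K : ℝ))⁻¹ * ‖q.1.2 - q.2.2‖) := by gcongr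
      _ = _ := by
        have : (K : ℝ) ≠ 0 := by positivity
        field_simp
  have h7 : ‖q.1.2 - q.2.2‖ = 0 := by linarith [norm_nonneg (q.1.2 - q.2.2)]
  exact sub_eq_zero.1 (norm_eq_zero.1 h7)

/-- The continuation of the stage values from step size `0` is unique. -/
theorem StageBranch.eqOn [FiniteDimensional ℝ V] {T : ButcherTableau s} {f : V → V}
    (hf : ContDiff ℝ 1 f) {x : V} {τ : ℝ} {Y Y' : ℝ → Fin s → V}
    (hY : T.StageBranch f τ x Y) (hY' : T.StageBranch f τ x Y') :
    Set.EqOn Y Y' (Set.uIcc 0 τ) := by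
  have : PreconnectedSpace (Set.uIcc 0 τ) :=
    Subtype.preconnectedSpace isPreconnected_uIcc
  have hc := hY.1.domRestrict
  have hc' := hY'.1.domRestrict
  -- the step sizes of agreement form a closed set by continuity, an open one by local uniqueness
  have hclopen : IsClopen {t : Set.uIcc 0 τ | Y t = Y' t} := by
    refine ⟨isClosed_eq hc hc', isOpen_iff_mem_nhds.2 fun t (ht : Y t = Y' t) => ?_⟩
    have hev := T.eventually_stageEq_unique hf x (hY.2 t t.2).2
    have htend : Filter.Tendsto (fun u : Set.uIcc 0 τ => (((u : ℝ), Y u), ((u : ℝ), Y' u))) (𝓝 t)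
        (𝓝 (((t : ℝ), Y t), ((t : ℝ), Y t))) := by
      have : Continuous (fun u : Set.uIcc 0 τ => (((u : ℝ), Y u), ((u : ℝ), Y' u))) :=
        (continuous_subtype_val.prodMk hc).prodMk (continuous_subtype_val.prodMk hc')
      exact this.tendsto' _ _ (by rw [ht])
    filter_upwards [htend.eventually hev] with u hu
    exact hu rfl (hY.2 u u.2).1 (hY'.2 u u.2).1
  have huniv := hclopen.eq_univ ⟨⟨0, Set.left_mem_uIcc⟩, by
    simp only [Set.mem_ofPred_eq]
    rw [hY.zero, hY'.zero]⟩
  intro t ht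
  have : (⟨t, ht⟩ : Set.uIcc 0 τ) ∈ {t : Set.uIcc 0 τ | Y t = Y' t} := by
    rw [huniv]; trivial
  exact this

/-- The result of a Runge-Kutta step is unique. -/
theorem Step.unique [FiniteDimensional ℝ V] {T : ButcherTableau s} {f : V → V}
    (hf : ContDiff ℝ 1 f) {x y z : V} {τ : ℝ} (hy : T.Step f τ x y) (hz : T.Step f τ x z) :
    y = z := by
  obtain ⟨Y, hY, rfl⟩ := hy
  obtain ⟨Z, hZ, rfl⟩ := hz
  rw [hY.eqOn hf hZ Set.right_mem_uIcc]

end Uniqueness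

section SmallStep

variable {s : ℕ} {V : Type*} [NormedAddCommGroup V] [NormedSpace ℝ V]

/-- The sum of the absolute values of all coefficients of the method, a crude bound for the weights
in each of its equations. -/
def weight (T : ButcherTableau s) : ℝ := ∑ i, ∑ j, |T.a i j| + ∑ i, |T.b i|

theorem weight_nonneg (T : ButcherTableau s) : 0 ≤ T.weight := by
  unfold weight
  positivity

theorem sum_abs_a_le (T : ButcherTableau s) (i : Fin s) : ∑ j, |T.a i j| ≤ T.weight := by
  have h1 : ∑ j, |T.a i j| ≤ ∑ i, ∑ j, |T.a i j| :=
    Finset.single_le_sum (f := fun i => ∑ j, |T.a i j|) (fun _ _ => by positivity)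
      (Finset.mem_univ i)
  have h2 : 0 ≤ ∑ i, |T.b i| := by positivity
  unfold weight
  linarith

theorem norm_smul_sum_smul_le {s : ℕ} (c : Fin s → ℝ) {S K τ σ : ℝ} (hc : ∑ j, |c j| ≤ S)
    (hσ : σ ∈ Set.uIcc 0 τ) {F : Fin s → V} (hF : ∀ j, ‖F j‖ ≤ K) (hK : 0 ≤ K) :
    ‖σ • ∑ j, c j • F j‖ ≤ |τ| * S * K := by
  have hστ : |σ| ≤ |τ| := by
    have := Set.abs_sub_left_of_mem_uIcc hσ
    simpa using this
  rw [norm_smul, Real.norm_eq_abs, mul_assoc]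
  have h1 : ‖∑ j, c j • F j‖ ≤ (∑ j, |c j|) * K := by
    rw [Finset.sum_mul]
    refine norm_sum_le_of_le _ fun j _ => ?_
    rw [norm_smul, Real.norm_eq_abs]
    exact mul_le_mul_of_nonneg_left (hF j) (abs_nonneg _)
  have h2 : (∑ j, |c j|) * K ≤ S * K := mul_le_mul_of_nonneg_right hc hK
  exact mul_le_mul hστ (h1.trans h2) (norm_nonneg _) (abs_nonneg _)

/-- For small step sizes the linearized stage equations are nondegenerate. -/
theorem stageRegular_of_small (T : ButcherTableau s) {f : V → V} {τ σ K : ℝ}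
    (hσ : σ ∈ Set.uIcc 0 τ) {Y : Fin s → V} (hK : 0 ≤ K) (hY : ∀ j, ‖fderiv ℝ f (Y j)‖ ≤ K)
    (hsmall : |τ| * T.weight * K < 1) : T.StageRegular f σ Y := by
  intro Z hZ
  have h1 : ‖Z‖ ≤ |τ| * T.weight * (K * ‖Z‖) := by
    have hnn : 0 ≤ |τ| * T.weight * (K * ‖Z‖) := by have := T.weight_nonneg; positivity
    refine (pi_norm_le_iff_of_nonneg hnn).2 fun i => ?_
    rw [hZ i]
    refine norm_smul_sum_smul_le _ (T.sum_abs_a_le i) hσ (fun j => ?_) (by positivity)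
    exact (ContinuousLinearMap.le_opNorm _ _).trans
      (mul_le_mul (hY j) (norm_le_pi_norm Z j) (norm_nonneg _) hK)
  have h2 : ‖Z‖ = 0 := by
    by_contra hne
    have hpos : 0 < ‖Z‖ := lt_of_le_of_ne (norm_nonneg _) (Ne.symm hne)
    nlinarith
  exact norm_eq_zero.1 h2

/-- Continuity argument: a continuous family of stage values starting at `x` stays in a ball
around `x`, provided the step size is small compared with a bound for the vector field. -/
theorem stage_mem_closedBall (T : ButcherTableau s) {f : V → V} {τ K R : ℝ} {x : V}
    {Y : ℝ → Fin s → V} (hR : 0 < R) (hK : 0 ≤ K) (hYc : ContinuousOn Y (Set.uIcc 0 τ))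
    (h0 : Y 0 = fun _ => x) (hf : ∀ y ∈ Metric.closedBall x R, ‖f y‖ ≤ K)
    (hY : ∀ σ ∈ Set.uIcc 0 τ, (∀ i, Y σ i ∈ Metric.closedBall x R) → T.StageEq f σ x (Y σ))
    (hsmall : |τ| * T.weight * K < R) :
    ∀ σ ∈ Set.uIcc 0 τ, ∀ i, Y σ i ∈ Metric.closedBall x R := by
  -- the distance to `x` cannot take the value `R`
  have key : ∀ σ ∈ Set.uIcc 0 τ, ‖Y σ - fun _ => x‖ ≤ R → ‖Y σ - fun _ => x‖ < R := by
    intro σ hσ hle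
    have hmem : ∀ i, Y σ i ∈ Metric.closedBall x R := fun i => by
      rw [mem_closedBall_iff_norm]
      exact (norm_le_pi_norm (Y σ - fun _ => x) i).trans hle
    refine (pi_norm_lt_iff hR).2 fun i => ?_
    have := hY σ hσ hmem i
    rw [Pi.sub_apply, this, add_sub_cancel_left]
    exact (norm_smul_sum_smul_le _ (T.sum_abs_a_le i) hσ (fun j => hf _ (hmem j)) hK).trans_lt
      hsmall
  have hcont : ContinuousOn (fun σ => ‖Y σ - fun _ => x‖) (Set.uIcc 0 τ) :=
    (hYc.sub continuousOn_const).norm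
  have main : ∀ σ ∈ Set.uIcc 0 τ, ‖Y σ - fun _ => x‖ < R := by
    intro σ hσ
    by_contra hge
    rw [not_lt] at hge
    obtain ⟨σ', hσ', heq⟩ := isPreconnected_uIcc.intermediate_value Set.left_mem_uIcc hσ hcont
      (show R ∈ Set.Icc _ _ from ⟨by simpa [h0] using hR.le, hge⟩)
    exact absurd (key σ' hσ' heq.le) (by simp [heq])
  intro σ hσ i
  rw [mem_closedBall_iff_norm]
  exact (norm_le_pi_norm (Y σ - fun _ => x) i).trans (main σ hσ).le

end SmallStep

end ButcherTableau

/-! ### The differential of the exponential map and the Bernoulli series -/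

section ExpDerivative

open NormedSpace MeasureTheory

variable {𝔸 : Type*} [NormedRing 𝔸] [NormedAlgebra ℝ 𝔸]

/-- The commutator `x ↦ a x - x a`. -/
def commutatorCLM (a : 𝔸) : 𝔸 →L[ℝ] 𝔸 :=
  ContinuousLinearMap.mul ℝ 𝔸 a - (ContinuousLinearMap.mul ℝ 𝔸).flip a

@[simp] theorem commutatorCLM_apply (a x : 𝔸) : commutatorCLM a x = a * x - x * a := rfl

theorem norm_commutatorCLM_le (a : 𝔸) : ‖commutatorCLM a‖ ≤ 2 * ‖a‖ := by
  refine ContinuousLinearMap.opNorm_le_bound _ (by positivity) fun x => ?_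
  rw [commutatorCLM_apply]
  calc _ ≤ ‖a * x‖ + ‖x * a‖ := norm_sub_le _ _
    _ ≤ ‖a‖ * ‖x‖ + ‖x‖ * ‖a‖ := add_le_add (norm_mul_le _ _) (norm_mul_le _ _)
    _ = _ := by ring

variable [CompleteSpace 𝔸]

theorem differentiable_normedSpace_exp : Differentiable ℝ (exp : 𝔸 → 𝔸) := fun x =>
  (exp_analytic (𝕂 := ℝ) x).differentiableAt

theorem contDiff_normedSpace_exp {n : WithTop ℕ∞} : ContDiff ℝ n (exp : 𝔸 → 𝔸) :=
  contDiff_iff_contDiffAt.2 fun x => (exp_analytic (𝕂 := ℝ) x).contDiffAt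

theorem hasDerivAt_exp_one_sub_smul_mul_exp_smul (a b : 𝔸) (s : ℝ) :
    HasDerivAt (fun s : ℝ => exp ((1 - s) • a) * exp (s • b))
      (exp ((1 - s) • a) * (b - a) * exp (s • b)) s := by
  have h1 : HasDerivAt (fun s : ℝ => exp ((1 - s) • a)) (-(exp ((1 - s) • a) * a)) s := by
    have := (hasDerivAt_exp_smul_const (𝕂 := ℝ) a (1 - s)).scomp s
      ((hasDerivAt_id s).const_sub 1)
    simpa [Function.comp_def] using this
  have h2 := hasDerivAt_exp_smul_const' (𝕂 := ℝ) b s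
  refine (h1.mul h2).congr_deriv ?_
  noncomm_ring

/-- Duhamel's formula. -/
theorem exp_sub_exp_eq_integral (a b : 𝔸) :
    exp b - exp a = ∫ s in (0 : ℝ)..1, exp ((1 - s) • a) * (b - a) * exp (s • b) := by
  have hc : Continuous fun s : ℝ => exp ((1 - s) • a) * (b - a) * exp (s • b) := by
    have := (differentiable_normedSpace_exp (𝔸 := 𝔸)).continuous
    fun_prop
  rw [intervalIntegral.integral_eq_sub_of_hasDerivAt
    (fun s _ => hasDerivAt_exp_one_sub_smul_mul_exp_smul a b s) (hc.intervalIntegrable _ _)]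
  simp

/-- The derivative of the exponential map, by Duhamel's formula for `a + ε h` and `a` in the limit
`ε → 0`. -/
theorem fderiv_exp_eq_integral (a h : 𝔸) :
    fderiv ℝ (exp : 𝔸 → 𝔸) a h = ∫ s in (0 : ℝ)..1, exp ((1 - s) • a) * h * exp (s • a) := by
  have hexp := (differentiable_normedSpace_exp (𝔸 := 𝔸)).continuous
  set J : ℝ → 𝔸 := fun ε => ∫ s in (0 : ℝ)..1, exp ((1 - s) • a) * h * exp (s • (a + ε • h))
    with hJ
  have hJc : Continuous J := by
    apply intervalIntegral.continuous_parametric_intervalIntegral_of_continuous'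
    fun_prop
  have hform : ∀ ε : ℝ, exp (a + ε • h) - exp a = ε • J ε := fun ε => by
    rw [exp_sub_exp_eq_integral, hJ, ← intervalIntegral.integral_smul]
    simp
  have h1 : HasDerivAt (fun ε : ℝ => exp (a + ε • h)) (fderiv ℝ (exp : 𝔸 → 𝔸) a h) 0 := by
    have hg : HasFDerivAt (exp : 𝔸 → 𝔸) (fderiv ℝ exp a) (a + (0 : ℝ) • h) := by
      simpa using (differentiable_normedSpace_exp a).hasFDerivAt
    refine hg.comp_hasDerivAt (0 : ℝ) ?_
    simpa using ((hasDerivAt_id (0 : ℝ)).smul_const h).const_add a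
  have h2 : HasDerivAt (fun ε : ℝ => exp (a + ε • h)) (J 0) 0 := by
    rw [hasDerivAt_iff_tendsto_slope_zero]
    have : Filter.Tendsto J (𝓝[≠] 0) (𝓝 (J 0)) := hJc.continuousAt.tendsto.mono_left inf_le_left
    refine this.congr' ?_
    filter_upwards [self_mem_nhdsWithin] with t ht
    have ht' : t ≠ 0 := ht
    simp only [zero_add, zero_smul, add_zero]
    rw [hform, smul_smul, inv_mul_cancel₀ ht', one_smul]
  rw [h1.unique h2, hJ]
  simp

/-- The exponential of the commutator map is conjugation with the exponential. -/
theorem exp_smul_commutatorCLM_apply (a h : 𝔸) (s : ℝ) :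
    exp (s • commutatorCLM a) h = exp (s • a) * h * exp (-(s • a)) := by
  -- `exp (-s ad) (exp (s a) h exp (-s a))` has derivative zero in `s`.
  set D := commutatorCLM a with hD
  have h1 : ∀ s : ℝ, HasDerivAt (fun s : ℝ => exp (s • a) * h * exp (s • (-a)))
      (D (exp (s • a) * h * exp (s • (-a)))) s := fun s => by
    have ha := (hasDerivAt_exp_smul_const' (𝕂 := ℝ) a s).mul_const h
    have hb := hasDerivAt_exp_smul_const (𝕂 := ℝ) (-a) s
    refine (ha.mul hb).congr_deriv ?_
    simp only [hD, commutatorCLM_apply]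
    noncomm_ring
  have h2 : ∀ s : ℝ, HasDerivAt
      (fun s : ℝ => exp (s • (-D)) (exp (s • a) * h * exp (s • (-a)))) 0 s := fun s => by
    have := (hasDerivAt_exp_smul_const (𝕂 := ℝ) (-D) s).clm_apply (h1 s)
    refine this.congr_deriv ?_
    simp
  have h3 : exp (s • (-D)) (exp (s • a) * h * exp (s • (-a))) = h := by
    have := is_const_of_deriv_eq_zero (fun s => (h2 s).differentiableAt)
      (fun s => (h2 s).deriv) s 0
    simpa using this
  have h4 : exp (s • D) * exp (s • (-D)) = 1 := by
    have := exp_add_of_commute_of_mem_ball (𝕂 := ℝ) ((Commute.refl (s • D)).neg_right)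
      ((expSeries_radius_eq_top ℝ (𝔸 →L[ℝ] 𝔸)).symm ▸ edist_lt_top _ _)
      ((expSeries_radius_eq_top ℝ (𝔸 →L[ℝ] 𝔸)).symm ▸ edist_lt_top _ _)
    rw [add_neg_cancel, exp_zero] at this
    rw [smul_neg]
    exact this.symm
  have h5 := congrArg (fun x => (exp (s • D) : 𝔸 →L[ℝ] 𝔸) x) h3
  rw [← mul_apply_eq_comp, h4] at h5
  simpa using h5.symm

/-- The integral of the exponential series over the unit interval. -/
theorem hasSum_integral_exp_smul (T : 𝔸) :
    HasSum (fun k : ℕ => (((k + 1).factorial : ℝ)⁻¹) • T ^ k)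
      (∫ s in (0 : ℝ)..1, exp (s • T)) := by
  let f : ℕ → C(ℝ, 𝔸) := fun k =>
    ⟨fun s => s ^ k • ((k.factorial : ℝ)⁻¹ • T ^ k), by fun_prop⟩
  have hf : Summable fun k => ‖(f k).restrict
      ((⟨Set.uIcc 0 1, isCompact_uIcc⟩ : TopologicalSpace.Compacts ℝ) : Set ℝ)‖ := by
    refine Summable.of_nonneg_of_le (fun _ => norm_nonneg _) (fun k => ?_)
      (norm_expSeries_summable' (𝕂 := ℝ) T)
    refine (ContinuousMap.norm_le _ (norm_nonneg _)).2 fun s => ?_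
    have hs : (s : ℝ) ∈ Set.Icc (0 : ℝ) 1 :=
      Set.uIcc_of_le (zero_le_one (α := ℝ)) ▸ (s.2 : (s : ℝ) ∈ Set.uIcc (0 : ℝ) 1)
    change ‖(s : ℝ) ^ k • ((k.factorial : ℝ)⁻¹ • T ^ k)‖ ≤ _
    rw [norm_smul]
    refine mul_le_of_le_one_left (norm_nonneg _) ?_
    rw [Real.norm_eq_abs, abs_pow, abs_of_nonneg hs.1]
    exact pow_le_one₀ hs.1 hs.2
  have := intervalIntegral.hasSum_intervalIntegral_of_summable_norm hf
  have h1 : ∀ k, ∫ s in (0 : ℝ)..1, f k s = (((k + 1).factorial : ℝ)⁻¹) • T ^ k := fun k => by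
    change ∫ s in (0 : ℝ)..1, s ^ k • ((k.factorial : ℝ)⁻¹ • T ^ k) = _
    rw [intervalIntegral.integral_smul_const, integral_pow, smul_smul]
    congr 1
    have : (k.factorial : ℝ) ≠ 0 := by positivity
    rw [Nat.factorial_succ]
    push_cast
    field_simp
    simp
  have h2 : ∀ s : ℝ, ∑' k, f k s = exp (s • T) := fun s => by
    rw [congrFun (exp_eq_tsum ℝ) (s • T)]
    refine tsum_congr fun k => ?_
    change s ^ k • ((k.factorial : ℝ)⁻¹ • T ^ k) = _
    rw [smul_pow, smul_comm]
  simpa only [h1, h2] using this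

/-- The differential of the exponential map, right trivialized. -/
theorem fderiv_exp_eq_dexp (a h : 𝔸) :
    fderiv ℝ (exp : 𝔸 → 𝔸) a h =
      (∑' k : ℕ, (((k + 1).factorial : ℝ)⁻¹) • commutatorCLM a ^ k) h * exp a := by
  have hexp := (differentiable_normedSpace_exp (𝔸 := 𝔸)).continuous
  have hexp' := (differentiable_normedSpace_exp (𝔸 := 𝔸 →L[ℝ] 𝔸)).continuous
  have key : ∀ s : ℝ, exp ((1 - s) • a) * h * exp (s • a) =
      exp ((1 - s) • commutatorCLM a) h * exp a := fun s => by
    rw [exp_smul_commutatorCLM_apply, mul_assoc _ _ (exp a)]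
    congr 1
    rw [← exp_add_of_commute_of_mem_ball (𝕂 := ℝ)
      (((Commute.refl a).smul_left _).neg_left)
      ((expSeries_radius_eq_top ℝ 𝔸).symm ▸ edist_lt_top _ _)
      ((expSeries_radius_eq_top ℝ 𝔸).symm ▸ edist_lt_top _ _)]
    congr 1
    module
  rw [fderiv_exp_eq_integral, (hasSum_integral_exp_smul (commutatorCLM a)).tsum_eq]
  simp only [key]
  rw [intervalIntegral.integral_comp_sub_left
    (fun s : ℝ => exp (s • commutatorCLM a) h * exp a) 1]
  simp only [sub_self, sub_zero]
  have hint : IntervalIntegrable (fun s : ℝ => exp (s • commutatorCLM a)) volume 0 1 :=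
    Continuous.intervalIntegrable (by fun_prop) _ _
  have := (((ContinuousLinearMap.mul ℝ 𝔸).flip (exp a)).comp
    (ContinuousLinearMap.apply ℝ 𝔸 h)).intervalIntegral_comp_comm hint
  simpa using this

end ExpDerivative

section Bernoulli

/-- The coefficients `B_j / j!` of the power series `z / (exp z - 1)`. -/
def bernoulliCoeff (j : ℕ) : ℝ := ((bernoulli j : ℚ) : ℝ) / (j.factorial : ℝ)

@[simp] theorem bernoulliCoeff_zero : bernoulliCoeff 0 = 1 := by simp [bernoulliCoeff]

/-- The recursion of the Bernoulli numbers: the power series of `z / (exp z - 1)` and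
`(exp z - 1) / z` are inverse to each other. -/
theorem sum_antidiagonal_bernoulliCoeff (n : ℕ) :
    ∑ q ∈ Finset.HasAntidiagonal.antidiagonal n, bernoulliCoeff q.1 * (((q.2 + 1).factorial : ℝ)⁻¹) =
      if n = 0 then 1 else 0 := by
  have h := congrArg (fun x : ℚ => (x : ℝ) / (n.factorial : ℝ)) (bernoulli_spec' n)
  have hr : (((if n = 0 then 1 else 0 : ℚ) : ℝ) / (n.factorial : ℝ)) = if n = 0 then 1 else 0 := by
    split_ifs with h0 <;> simp [h0]
  rw [hr] at h
  rw [← h, Rat.cast_sum, Finset.sum_div]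
  refine Finset.sum_congr rfl fun q hq => ?_
  have hq' := Finset.HasAntidiagonal.mem_antidiagonal.1 hq
  subst hq'
  have h1 := Nat.add_choose_mul_factorial_mul_factorial q.1 q.2
  have h2 : ((q.1 + q.2).factorial : ℝ) =
      ((q.1 + q.2).choose q.2 : ℝ) * q.1.factorial * q.2.factorial := by
    rw [← h1]
    push_cast
    ring
  have hc : ((q.1 + q.2).choose q.2 : ℝ) ≠ 0 := by
    exact_mod_cast (Nat.choose_pos (Nat.le_add_left _ _)).ne'
  have hf1 : (q.1.factorial : ℝ) ≠ 0 := by positivity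
  have hf2 : (q.2.factorial : ℝ) ≠ 0 := by positivity
  rw [bernoulliCoeff, h2, Nat.factorial_succ]
  push_cast
  field_simp

/-- A crude bound, from the recursion by strong induction. It gives a radius of convergence of at
least `1` for the Bernoulli series, which suffices since only small arguments matter. -/
theorem abs_bernoulliCoeff_le_one (n : ℕ) : |bernoulliCoeff n| ≤ 1 := by
  induction n using Nat.strong_induction_on with
  | _ n ih =>
    rcases Nat.eq_zero_or_pos n with rfl | hn
    · simp
    have h := sum_antidiagonal_bernoulliCoeff n
    rw [if_neg hn.ne', Finset.Nat.sum_antidiagonal_eq_sum_range_succ_mk,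
      Finset.sum_range_succ] at h
    simp only [Nat.sub_self, zero_add, Nat.factorial_one, Nat.cast_one, inv_one, mul_one] at h
    have h1 : bernoulliCoeff n =
        -∑ k ∈ Finset.range n, bernoulliCoeff k * (((n - k + 1).factorial : ℝ)⁻¹) := by linarith
    rw [h1, abs_neg]
    -- compare `1 / (m + 1)!` with `2 ^ (-m)`
    have hfac : ∀ m : ℕ, ((m + 1).factorial : ℝ)⁻¹ ≤ (1 / 2) ^ m := fun m => by
      have h2 : 2 ^ m ≤ (m + 1).factorial := by
        induction m with
        | zero => simp
        | succ m ihm =>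
          rw [pow_succ, Nat.factorial_succ, mul_comm]
          exact Nat.mul_le_mul (by omega) ihm
      rw [one_div, inv_pow]
      exact inv_anti₀ (by positivity) (by exact_mod_cast h2)
    calc |∑ k ∈ Finset.range n, bernoulliCoeff k * (((n - k + 1).factorial : ℝ)⁻¹)|
        ≤ ∑ k ∈ Finset.range n, (1 / 2 : ℝ) ^ (n - k) := by
          refine (Finset.abs_sum_le_sum_abs _ _).trans (Finset.sum_le_sum fun k hk => ?_)
          have hk' := Finset.mem_range.1 hk
          rw [abs_mul, abs_of_nonneg (by positivity : (0 : ℝ) ≤ ((n - k + 1).factorial : ℝ)⁻¹)]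
          calc _ ≤ 1 * ((n - k + 1).factorial : ℝ)⁻¹ := by gcongr; exact ih k hk'
            _ ≤ _ := by rw [one_mul]; exact hfac _
      _ = ∑ k ∈ Finset.range n, (1 / 2 : ℝ) ^ (k + 1) := by
          rw [← Finset.sum_range_reflect]
          refine Finset.sum_congr rfl fun k hk => ?_
          have hk' := Finset.mem_range.1 hk
          congr 1
          omega
      _ = 1 - (1 / 2 : ℝ) ^ n := by
          clear h h1 ih hn
          induction n with
          | zero => simp
          | succ m ihm => rw [Finset.sum_range_succ, ihm]; ring
      _ ≤ 1 := by
          have : (0 : ℝ) ≤ (1 / 2) ^ n := by positivity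
          linarith

end Bernoulli

section PowerSeries

variable {𝔹 : Type*} [NormedRing 𝔹] [NormedAlgebra ℝ 𝔹]

theorem summable_norm_smul_pow {c : ℕ → ℝ} (hc : ∀ j, |c j| ≤ 1) {T : 𝔹} (hT : ‖T‖ < 1) :
    Summable fun j => ‖c j • T ^ j‖ := by
  refine Summable.of_norm_bounded_eventually_nat (summable_geometric_of_lt_one (norm_nonneg T) hT)
    ?_
  filter_upwards [Filter.eventually_gt_atTop 0] with j hj
  rw [norm_norm, norm_smul, Real.norm_eq_abs]
  calc _ ≤ 1 * ‖T ^ j‖ := by gcongr; exact hc j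
    _ ≤ _ := by rw [one_mul]; exact norm_pow_le' T hj

variable [CompleteSpace 𝔹]

/-- The Bernoulli series inverts the series of `(exp z - 1) / z`, by the Cauchy product. -/
theorem dexp_mul_bernoulli {T : 𝔹} (hT : ‖T‖ < 1) :
    (∑' k : ℕ, (((k + 1).factorial : ℝ)⁻¹) • T ^ k) * ∑' j, bernoulliCoeff j • T ^ j = 1 := by
  have h1 := summable_norm_smul_pow (c := fun k : ℕ => (((k + 1).factorial : ℝ)⁻¹)) (fun k => by
    rw [abs_of_nonneg (by positivity)]
    refine inv_le_one_of_one_le₀ ?_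
    exact_mod_cast Nat.succ_le_of_lt (Nat.factorial_pos (k + 1))) hT
  have h2 := summable_norm_smul_pow abs_bernoulliCoeff_le_one hT
  rw [tsum_mul_tsum_eq_tsum_sum_antidiagonal_of_summable_norm h1 h2]
  have h3 : ∀ n, ∑ q ∈ Finset.HasAntidiagonal.antidiagonal n,
      ((((q.1 + 1).factorial : ℝ)⁻¹) • T ^ q.1) * (bernoulliCoeff q.2 • T ^ q.2) =
      if n = 0 then 1 else 0 := fun n => by
    have : ∀ q ∈ Finset.HasAntidiagonal.antidiagonal n,
        ((((q.1 + 1).factorial : ℝ)⁻¹) • T ^ q.1) * (bernoulliCoeff q.2 • T ^ q.2) =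
        (bernoulliCoeff q.2 * (((q.1 + 1).factorial : ℝ)⁻¹)) • T ^ n := fun q hq => by
      rw [smul_mul_smul_comm, ← pow_add, Finset.HasAntidiagonal.mem_antidiagonal.1 hq, mul_comm]
    rw [Finset.sum_congr rfl this, ← Finset.sum_smul]
    rw [← Finset.Nat.sum_antidiagonal_swap (n := n)
      (f := fun q => bernoulliCoeff q.2 * (((q.1 + 1).factorial : ℝ)⁻¹))]
    simp only [Prod.fst_swap, Prod.snd_swap]
    rw [sum_antidiagonal_bernoulliCoeff]
    split_ifs with h0 <;> simp [h0]
  simp only [h3]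
  exact tsum_ite_eq 0 (fun _ => (1 : 𝔹))

theorem contDiffOn_tsum_smul_pow {c : ℕ → ℝ} (hc : ∀ j, |c j| ≤ 1) {n : WithTop ℕ∞} :
    ContDiffOn ℝ n (fun T : 𝔹 => ∑' j, c j • T ^ j) (Metric.ball 0 1) := by
  set P := FormalMultilinearSeries.ofScalars 𝔹 c with hP
  have hrad : (1 : ENNReal) ≤ P.radius := by
    refine P.le_radius_of_bound (max 1 ‖P 0‖) (r := 1) fun k => ?_
    simp only [NNReal.coe_one, one_pow, mul_one]
    rcases Nat.eq_zero_or_pos k with rfl | hk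
    · exact le_max_right _ _
    · refine ((FormalMultilinearSeries.ofScalars_norm_le 𝔹 c k hk).trans ?_).trans
        (le_max_left _ _)
      exact hc k
  have hser := P.hasFPowerSeriesOnBall (zero_lt_one.trans_le hrad)
  have hsum : P.sum = fun T : 𝔹 => ∑' j, c j • T ^ j :=
    FormalMultilinearSeries.ofScalarsSum_eq_tsum c
  intro T hT
  have : T ∈ Metric.eball (0 : 𝔹) P.radius := by
    refine Metric.eball_subset_eball hrad ?_
    have : Metric.eball (0 : 𝔹) 1 = Metric.ball 0 1 := by
      rw [← ENNReal.ofReal_one, Metric.eball_ofReal]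
    rw [this]; exact hT
  have := (hser.analyticAt_of_mem this).contDiffAt (n := n)
  rw [hsum] at this
  exact this.contDiffWithinAt

end PowerSeries

section DexpInverse

open NormedSpace

variable {𝔸 : Type*} [NormedRing 𝔸] [NormedAlgebra ℝ 𝔸] [CompleteSpace 𝔸]

/-- The Bernoulli series inverts the right trivialized differential of the exponential map. -/
theorem fderiv_exp_bernoulli {a : 𝔸} (ha : ‖commutatorCLM a‖ < 1) (b : 𝔸) :
    fderiv ℝ (exp : 𝔸 → 𝔸) a ((∑' j, bernoulliCoeff j • commutatorCLM a ^ j) b) = b * exp a := by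
  rw [fderiv_exp_eq_dexp, ← mul_apply_eq_comp, dexp_mul_bernoulli ha]
  simp

end DexpInverse

/-! ### Differential equations with a time scale -/

section ScaledODE

variable {W : Type*} [NormedAddCommGroup W] [NormedSpace ℝ W]

/-- Rescaling time maps solutions of `y' = X y` between `0` and `τ` to solutions of `y' = τ X y`
on the unit interval, for both signs of `τ`. -/
theorem hasDerivWithinAt_rescale {X : W → W} {y : ℝ → W} {τ : ℝ}
    (hy : ∀ t ∈ Set.uIcc 0 τ, HasDerivWithinAt y (X (y t)) (Set.uIcc 0 τ) t) :
    ∀ t ∈ Set.Icc (0 : ℝ) 1,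
      HasDerivWithinAt (fun t => y (t * τ)) (τ • X (y (t * τ))) (Set.Icc 0 1) t := by
  have hmaps : Set.MapsTo (fun t : ℝ => t * τ) (Set.Icc 0 1) (Set.uIcc 0 τ) := fun t ht => by
    rcases le_total 0 τ with h | h
    · rw [Set.uIcc_of_le h]
      exact ⟨mul_nonneg ht.1 h, mul_le_of_le_one_left h ht.2⟩
    · rw [Set.uIcc_of_ge h]
      exact ⟨by nlinarith [ht.1, ht.2], mul_nonpos_of_nonneg_of_nonpos ht.1 h⟩
  intro t ht
  have h1 : HasDerivWithinAt (fun t : ℝ => t * τ) τ (Set.Icc 0 1) t := by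
    simpa using (hasDerivWithinAt_id t (Set.Icc (0 : ℝ) 1)).mul_const τ
  exact (hy _ (hmaps ht)).scomp t h1 hmaps

/-- A solution stays in a ball around its initial value for as long as the bound of the vector
field on that ball permits. -/
theorem norm_sub_le_of_scaled_solution {X : W → W} {w : ℝ → W} {τ K R : ℝ} {x : W}
    (h0 : w 0 = x) (hK0 : 0 ≤ K) (hK : ∀ y ∈ Metric.closedBall x R, ‖X y‖ ≤ K)
    (hw : ∀ t ∈ Set.Icc (0 : ℝ) 1, HasDerivWithinAt w (τ • X (w t)) (Set.Icc 0 1) t)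
    (hsmall : |τ| * K < R) : ∀ t ∈ Set.Icc (0 : ℝ) 1, ‖w t - x‖ ≤ |τ| * K := by
  intro t ht
  refine le_of_forall_gt_imp_ge_of_dense fun M' hM' => ?_
  -- compare with linear growth of a slope slightly above `|τ| K`
  set M := min M' R with hM
  have hM1 : |τ| * K < M := lt_min hM' hsmall
  have hM0 : 0 < M := lt_of_le_of_lt (by positivity) hM1
  have := image_norm_le_of_norm_deriv_right_lt_deriv_boundary' (a := 0) (b := 1)
    (f := fun t => w t - x) (f' := fun t => τ • X (w t)) (B := fun t => M * t) (B' := fun _ => M)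
    ((fun t ht => (hw t ht).continuousWithinAt.sub continuousWithinAt_const))
    (fun t ht => (((hw t (Set.Ico_subset_Icc_self ht)).mono_of_mem_nhdsWithin
      (Icc_mem_nhdsGE_of_mem ht)).sub_const x))
    (by simp [h0]) (by fun_prop)
    (fun t _ => by simpa using ((hasDerivAt_id t).const_mul M).hasDerivWithinAt)
    (fun t ht heq => by
      have hle : ‖w t - x‖ ≤ R := by
        rw [heq]
        have := min_le_right M' R
        nlinarith [ht.1, ht.2]
      rw [norm_smul, Real.norm_eq_abs]
      exact (mul_le_mul_of_nonneg_left (hK _ (mem_closedBall_iff_norm.2 hle))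
        (abs_nonneg τ)).trans_lt hM1) ht
  calc ‖w t - x‖ ≤ M * t := this
    _ ≤ M := mul_le_of_le_one_right hM0.le ht.2
    _ ≤ M' := min_le_left _ _

/-- Local existence for a smooth vector field, with a time of existence that is uniform near the
given point, for both signs of time. -/
theorem exists_solution_uIcc [CompleteSpace W] {X : W → W} (hX : ContDiff ℝ 1 X) (x₀ : W) :
    ∀ᶠ q : ℝ × W in 𝓝 ((0 : ℝ), x₀), ∃ y : ℝ → W, y 0 = q.2 ∧
      ∀ t ∈ Set.uIcc 0 q.1, HasDerivWithinAt y (X (y t)) (Set.uIcc 0 q.1) t := by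
  obtain ⟨r, hr, ε, hε, H⟩ :=
    hX.contDiffAt.exists_forall_mem_closedBall_exists_eq_forall_mem_Ioo_hasDerivAt (x₀ := x₀) 0
  have hball : Metric.ball (0 : ℝ) ε ×ˢ Metric.closedBall x₀ r ∈ 𝓝 ((0 : ℝ), x₀) :=
    prod_mem_nhds (Metric.ball_mem_nhds _ hε) (Metric.closedBall_mem_nhds _ hr)
  filter_upwards [hball] with q hq
  obtain ⟨α, h0, hα⟩ := H q.2 hq.2
  refine ⟨α, h0, fun t ht => (hα t ?_).hasDerivWithinAt⟩
  have hq1 : |q.1| < ε := by simpa using hq.1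
  have ht1 : |t| ≤ |q.1| := by simpa using Set.abs_sub_left_of_mem_uIcc ht
  have := abs_lt.1 (ht1.trans_lt hq1)
  exact ⟨by linarith [this.1], by linarith [this.2]⟩

/-- Grönwall's inequality for a solution of `y' = τ X y` and an approximate solution. -/
theorem norm_sub_le_of_scaled_approx {X : W → W} {S : Set W} {K : NNReal}
    (hX : LipschitzOnWith K X S) {τ ε : ℝ} (hτ : |τ| ≤ 1) {y z e : ℝ → W}
    (hyS : ∀ t ∈ Set.Icc (0 : ℝ) 1, y t ∈ S) (hzS : ∀ t ∈ Set.Icc (0 : ℝ) 1, z t ∈ S)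
    (h0 : z 0 = y 0)
    (hy : ∀ t ∈ Set.Icc (0 : ℝ) 1, HasDerivWithinAt y (τ • X (y t)) (Set.Icc 0 1) t)
    (hz : ∀ t ∈ Set.Icc (0 : ℝ) 1, HasDerivWithinAt z (τ • X (z t) + e t) (Set.Icc 0 1) t)
    (he : ∀ t ∈ Set.Icc (0 : ℝ) 1, ‖e t‖ ≤ ε) :
    ‖z 1 - y 1‖ ≤ ε * gronwallBound 0 K 1 1 := by
  have hlip : LipschitzOnWith K (fun v => τ • X v) S := by
    refine LipschitzOnWith.of_dist_le_mul fun a ha b hb => ?_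
    rw [dist_eq_norm, ← smul_sub, norm_smul, ← dist_eq_norm]
    exact (mul_le_of_le_one_left dist_nonneg hτ).trans (hX.dist_le_mul a ha b hb)
  have hsub : Set.Ico (0 : ℝ) 1 ⊆ Set.Icc 0 1 := Set.Ico_subset_Icc_self
  have := dist_le_of_approx_trajectories_ODE_of_mem (v := fun _ v => τ • X v) (s := fun _ => S)
    (K := K) (a := 0) (b := 1) (f := z) (g := y) (f' := fun t => τ • X (z t) + e t)
    (g' := fun t => τ • X (y t)) (εf := ε) (εg := 0) (δ := 0)
    (fun _ _ => hlip) (fun t ht => (hz t ht).continuousWithinAt)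
    (fun t ht => (hz t (hsub ht)).mono_of_mem_nhdsWithin (Icc_mem_nhdsGE_of_mem ht))
    (fun t ht => by simpa [dist_eq_norm] using he t (hsub ht)) (fun t ht => hzS t (hsub ht))
    (fun t ht => (hy t ht).continuousWithinAt)
    (fun t ht => (hy t (hsub ht)).mono_of_mem_nhdsWithin (Icc_mem_nhdsGE_of_mem ht))
    (fun t _ => by simp) (fun t ht => hyS t (hsub ht)) (by simp [h0]) 1 (by simp)
  rw [dist_eq_norm, add_zero, sub_zero] at this
  refine this.trans (le_of_eq ?_)
  by_cases hK : (K : ℝ) = 0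
  · simp [hK, gronwallBound_K0]
  · simp only [gronwallBound_of_K_ne_0 hK]
    ring

end ScaledODE

section Cutoff

variable {E V F : Type*} [NormedAddCommGroup E] [NormedSpace ℝ E] [FiniteDimensional ℝ E]
  [NormedAddCommGroup V] [NormedSpace ℝ V] [NormedAddCommGroup F] [NormedSpace ℝ F]

/-- A map that is smooth where its first argument is small agrees there with a smooth map. -/
theorem exists_contDiff_eq_of_contDiffOn_ball {f : E × V → F} {ε : ℝ} (hε : 0 < ε)
    (hf : ContDiffOn ℝ ∞ f (Metric.ball 0 ε ×ˢ Set.univ)) :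
    ∃ g : E × V → F, ContDiff ℝ ∞ g ∧ ∀ u ∈ Metric.closedBall (0 : E) (ε / 2), ∀ m,
      g (u, m) = f (u, m) := by
  let χ : ContDiffBump (0 : E) := ⟨ε / 2, 3 * ε / 4, by linarith, by linarith⟩
  refine ⟨fun q => χ q.1 • f q, contDiff_iff_contDiffAt.2 fun q => ?_, fun u hu m => ?_⟩
  · by_cases hq : q.1 ∈ Metric.ball (0 : E) ε
    · have hopen : Metric.ball (0 : E) ε ×ˢ (Set.univ : Set V) ∈ 𝓝 q :=
        (Metric.isOpen_ball.prod isOpen_univ).mem_nhds ⟨hq, trivial⟩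
      exact (χ.contDiff.comp contDiff_fst).contDiffAt.smul (hf.contDiffAt hopen)
    · have hzero : (fun q : E × V => χ q.1 • f q) =ᶠ[𝓝 q] fun _ => 0 := by
        have hq' : q.1 ∉ tsupport χ := fun h => hq (by
          rw [χ.tsupport_eq] at h
          exact Metric.closedBall_subset_ball (by change 3 * ε / 4 < ε; linarith) h)
        have hev : ∀ᶠ u in 𝓝 q.1, χ u = 0 := notMem_tsupport_iff_eventuallyEq.1 hq'
        filter_upwards [continuous_fst.continuousAt.eventually hev] with a ha
        rw [ha, zero_smul]
      exact contDiffAt_const.congr_of_eventuallyEq hzero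
  · have : χ u = 1 := χ.one_of_mem_closedBall hu
    simp [this]

end Cutoff

/-! ### Stage equations of the system on the Lie algebra, and truncation of the Bernoulli series -/

section StageReduction

variable {E V : Type*} [NormedAddCommGroup E] [NormedSpace ℝ E] [FiniteDimensional ℝ E]
  [NormedAddCommGroup V] [NormedSpace ℝ V] [FiniteDimensional ℝ V] {s : ℕ}

theorem exists_forall_closedBall_norm_le {W F : Type*} [NormedAddCommGroup W] [NormedSpace ℝ W]
    [FiniteDimensional ℝ W] [NormedAddCommGroup F] {f : W → F} (hf : Continuous f)
    (x : W) (R : ℝ) : ∃ K : ℝ, 1 ≤ K ∧ ∀ y ∈ Metric.closedBall x R, ‖f y‖ ≤ K := by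
  have := FiniteDimensional.proper ℝ W
  obtain ⟨K, hK⟩ := (isCompact_closedBall x R).exists_bound_of_continuousOn hf.continuousOn
  exact ⟨max 1 K, le_max_left _ _, fun y hy => (hK y hy).trans (le_max_right _ _)⟩

theorem eventually_abs_mul_lt {W : Type*} [TopologicalSpace W] (x₀ : W) (K : ℝ) {R : ℝ}
    (hR : 0 < R) : ∀ᶠ q : ℝ × W in 𝓝 ((0 : ℝ), x₀), |q.1| * K < R := by
  have : Continuous fun q : ℝ × W => |q.1| * K := by fun_prop
  exact (this.tendsto' (0, x₀) 0 (by simp)).eventually (gt_mem_nhds hR)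

/-- For small step sizes, the stage equations for `u' = f (u, m)`, `m' = Y m` with a field `f`
that is only defined near `u = 0` are the same as the stage equations for a globally smooth
vector field that extends it. -/
theorem eventually_stageBranch_iff (T : ButcherTableau s) {f : E × V → E} {Y : V → V}
    {H : E × V → E × V} {ρ : ℝ} (hρ : 0 < ρ) (hY : ContDiff ℝ ∞ Y) (hH : ContDiff ℝ ∞ H)
    (hfst : ∀ u ∈ Metric.closedBall (0 : E) ρ, ∀ m, (H (u, m)).1 = f (u, m))
    (hsnd : ∀ q, (H q).2 = Y q.2) (x₀ : V) :
    ∀ᶠ q : ℝ × V in 𝓝 ((0 : ℝ), x₀),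
      (∀ (M : ℝ → Fin s → V) (U : ℝ → Fin s → E), T.StageBranch Y q.1 q.2 M →
        ContinuousOn U (Set.uIcc 0 q.1) →
        (∀ σ ∈ Set.uIcc 0 q.1, ∀ i, U σ i = σ • ∑ j, T.a i j • f (U σ j, M σ j)) →
        T.Step H q.1 (0, q.2)
          (q.1 • ∑ i, T.b i • f (U q.1 i, M q.1 i), T.update Y q.1 q.2 (M q.1))) ∧
      ∀ Z : ℝ → Fin s → E × V, T.StageBranch H q.1 (0, q.2) Z →
        T.StageBranch Y q.1 q.2 (fun σ i => (Z σ i).2) ∧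
        ContinuousOn (fun σ i => (Z σ i).1) (Set.uIcc 0 q.1) ∧
        ∀ σ ∈ Set.uIcc 0 q.1, (∀ i, ‖(Z σ i).1‖ ≤ ρ) ∧
          ∀ i, (Z σ i).1 = σ • ∑ j, T.a i j • f (Z σ j) := by
  obtain ⟨K, hK1, hK⟩ := exists_forall_closedBall_norm_le hH.continuous ((0 : E), x₀) (2 * ρ)
  obtain ⟨K', hK'1, hK'⟩ := exists_forall_closedBall_norm_le
    (hH.continuous_fderiv (by simp)) ((0 : E), x₀) (2 * ρ)
  obtain ⟨K₂, hK₂1, hK₂⟩ := exists_forall_closedBall_norm_le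
    (hY.continuous_fderiv (by simp)) x₀ (2 * ρ)
  have hx : ∀ᶠ q : ℝ × V in 𝓝 ((0 : ℝ), x₀), dist q.2 x₀ < ρ :=
    (continuous_snd.tendsto ((0 : ℝ), x₀)).eventually (Metric.ball_mem_nhds x₀ hρ)
  filter_upwards [hx, eventually_abs_mul_lt x₀ (T.weight * K) hρ,
    eventually_abs_mul_lt x₀ (T.weight * K') one_pos,
    eventually_abs_mul_lt x₀ (T.weight * K₂) one_pos] with ⟨τ, x⟩ hx h1 h2 h3
  simp only [← mul_assoc] at h1 h2 h3 hx ⊢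
  have hsub : Metric.closedBall ((0 : E), x) ρ ⊆ Metric.closedBall ((0 : E), x₀) (2 * ρ) := by
    refine Metric.closedBall_subset_closedBall' ?_
    have : dist ((0 : E), x) ((0 : E), x₀) = dist x x₀ := by simp [Prod.dist_eq]
    rw [this]
    linarith
  have hbound : ∀ y ∈ Metric.closedBall ((0 : E), x) ρ, ‖H y‖ ≤ K := fun y hy => hK y (hsub hy)
  have hfstmem : ∀ y ∈ Metric.closedBall ((0 : E), x) ρ, y.1 ∈ Metric.closedBall (0 : E) ρ := by
    intro y hy
    rw [mem_closedBall_iff_norm] at hy ⊢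
    exact (norm_fst_le (y - (0, x))).trans hy
  constructor
  · intro M U hM hUc hU
    have hM0 := hM.zero
    have hU0 : U 0 = fun _ => 0 := by
      funext i
      simpa using hU 0 Set.left_mem_uIcc i
    set Z : ℝ → Fin s → E × V := fun σ i => (U σ i, M σ i) with hZ
    have hZc : ContinuousOn Z (Set.uIcc 0 τ) := continuousOn_pi.2 fun i =>
      (continuousOn_pi.1 hUc i).prodMk (continuousOn_pi.1 hM.1 i)
    have heq : ∀ σ ∈ Set.uIcc 0 τ, (∀ i, Z σ i ∈ Metric.closedBall ((0 : E), x) ρ) →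
        T.StageEq H σ (0, x) (Z σ) := by
      intro σ hσ hmem i
      have hj : ∀ j, H (Z σ j) = (f (U σ j, M σ j), Y (M σ j)) := fun j =>
        Prod.ext (hfst _ (hfstmem _ (hmem j)) _) (hsnd _)
      simp only [hj]
      refine Prod.ext ?_ ?_
      · simpa [hZ, Prod.fst_sum] using hU σ hσ i
      · simpa [hZ, Prod.snd_sum] using (hM.2 σ hσ).1 i
    have hmem := T.stage_mem_closedBall hρ (by linarith) hZc (by simp [hZ, hU0, hM0]) hbound heq h1
    refine ⟨Z, ⟨hZc, fun σ hσ => ⟨heq σ hσ (hmem σ hσ), ?_⟩⟩, ?_⟩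
    · exact T.stageRegular_of_small hσ (by linarith) (fun j => hK' _ (hsub (hmem σ hσ j))) h2
    · have hj : ∀ j, H (Z τ j) = (f (U τ j, M τ j), Y (M τ j)) := fun j =>
        Prod.ext (hfst _ (hfstmem _ (hmem τ Set.right_mem_uIcc j)) _) (hsnd _)
      simp only [ButcherTableau.update, hj]
      refine Prod.ext ?_ ?_
      · simp [Prod.fst_sum]
      · simp [Prod.snd_sum]
  · intro Z hZ
    have hmem := T.stage_mem_closedBall hρ (by linarith) hZ.1 hZ.zero hbound
      (fun σ hσ _ => (hZ.2 σ hσ).1) h1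
    refine ⟨⟨?_, fun σ hσ => ⟨fun i => ?_, ?_⟩⟩, ?_, fun σ hσ => ⟨fun i => ?_, fun i => ?_⟩⟩
    · exact continuousOn_pi.2 fun i =>
        continuous_snd.comp_continuousOn (continuousOn_pi.1 hZ.1 i)
    · have := congrArg Prod.snd ((hZ.2 σ hσ).1 i)
      simpa [Prod.snd_sum, hsnd] using this
    · refine T.stageRegular_of_small hσ (by linarith) (fun j => hK₂ _ ?_) h3
      have := hsub (hmem σ hσ j)
      rw [mem_closedBall_iff_norm] at this ⊢
      exact (norm_snd_le (Z σ j - (0, x₀))).trans this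
    · exact continuousOn_pi.2 fun i =>
        continuous_fst.comp_continuousOn (continuousOn_pi.1 hZ.1 i)
    · simpa using hfstmem _ (hmem σ hσ i)
    · have := congrArg Prod.fst ((hZ.2 σ hσ).1 i)
      have hj : ∀ j, (H (Z σ j)).1 = f (Z σ j) := fun j => hfst _ (hfstmem _ (hmem σ hσ j)) _
      simpa [Prod.fst_sum, hj] using this

end StageReduction

section BracketSeries

variable {E : Type*} [NormedAddCommGroup E] [NormedSpace ℝ E] [CompleteSpace E]

theorem hasSum_smul_pow_apply {c : ℕ → ℝ} (hc : ∀ j, |c j| ≤ 1) {D : E →L[ℝ] E} (hD : ‖D‖ < 1)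
    (v : E) : HasSum (fun j => c j • (D ^ j) v) ((∑' j, c j • D ^ j) v) := by
  have := (summable_norm_smul_pow hc hD).of_norm.hasSum
  simpa using (ContinuousLinearMap.apply ℝ E v).hasSum this

/-- If the coefficients up to index `n` vanish, then the series `∑ d j D ^ j v` is of order
`‖D‖ ^ n * ‖D v‖`. -/
theorem norm_tsum_smul_pow_apply_le {d : ℕ → ℝ} (hd : ∀ j, |d j| ≤ 1) (n : ℕ)
    (hd0 : ∀ j ≤ n, d j = 0) {D : E →L[ℝ] E} (hD : ‖D‖ ≤ 1 / 2) (v : E) :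
    ‖(∑' j, d j • D ^ j) v‖ ≤ 2 ^ (n + 2) * ‖D‖ ^ n * ‖D v‖ := by
  rw [← (hasSum_smul_pow_apply hd (by linarith) v).tsum_eq]
  have hgeo : HasSum (fun j : ℕ => (2 ^ (n + 1) * ‖D‖ ^ n * ‖D v‖) * (1 / 2) ^ j)
      ((2 ^ (n + 1) * ‖D‖ ^ n * ‖D v‖) * 2) := hasSum_geometric_two.mul_left _
  refine (tsum_of_norm_bounded hgeo fun j => ?_).trans (le_of_eq (by ring))
  rcases le_or_gt j n with hj | hj
  · rw [hd0 j hj, zero_smul, norm_zero]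
    positivity
  · obtain ⟨k, rfl⟩ := Nat.exists_eq_add_of_lt hj
    have h1 : ‖(D ^ (n + k + 1)) v‖ ≤ ‖D‖ ^ n * (1 / 2) ^ k * ‖D v‖ := by
      rw [pow_succ]
      refine (ContinuousLinearMap.le_opNorm (D ^ (n + k)) (D v)).trans ?_
      gcongr
      have h0 : ‖D ^ (n + k)‖ ≤ ‖D‖ ^ (n + k) := by
        rcases Nat.eq_zero_or_pos (n + k) with h | h
        · rw [h, pow_zero, pow_zero]
          exact ContinuousLinearMap.norm_id_le
        · exact norm_pow_le' D h
      refine h0.trans ?_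
      rw [pow_add]
      gcongr
    rw [norm_smul, Real.norm_eq_abs]
    calc _ ≤ 1 * (‖D‖ ^ n * (1 / 2) ^ k * ‖D v‖) := by gcongr; exact hd _
      _ = _ := by
        rw [show n + k + 1 = (n + 1) + k by ring, pow_add (1 / 2 : ℝ)]
        have : (2 : ℝ) ^ (n + 1) * (1 / 2) ^ (n + 1) = 1 := by rw [← mul_pow]; norm_num
        linear_combination -(‖D‖ ^ n * (1 / 2) ^ k * ‖D v‖) * this

/-- The coefficients `B_j / j!` of the series of `dexp⁻¹`, truncated at the index `r`. -/
def truncBernoulliCoeff (r : ℕ∞) (j : ℕ) : ℝ :=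
  open Classical in if (j : ℕ∞) ≤ r then bernoulliCoeff j else 0

theorem abs_truncBernoulliCoeff_le_one (r : ℕ∞) (j : ℕ) : |truncBernoulliCoeff r j| ≤ 1 := by
  unfold truncBernoulliCoeff
  split_ifs
  · exact abs_bernoulliCoeff_le_one j
  · simp

@[simp] theorem truncBernoulliCoeff_zero (r : ℕ∞) : truncBernoulliCoeff r 0 = 1 := by
  simp [truncBernoulliCoeff]

theorem tsum_smul_pow_sub {c d : ℕ → ℝ} (hc : ∀ j, |c j| ≤ 1) (hd : ∀ j, |d j| ≤ 1)
    {D : E →L[ℝ] E} (hD : ‖D‖ < 1) :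
    (∑' j, c j • D ^ j) - ∑' j, d j • D ^ j = ∑' j, (c j - d j) • D ^ j := by
  rw [← ((summable_norm_smul_pow hc hD).of_norm).tsum_sub (summable_norm_smul_pow hd hD).of_norm]
  simp only [sub_smul]

/-- The first-order behaviour of the series of `dexp⁻¹`. -/
theorem norm_truncBernoulli_apply_sub_le (r : ℕ∞) {D : E →L[ℝ] E} (hD : ‖D‖ ≤ 1 / 2) (v : E) :
    ‖(∑' j, truncBernoulliCoeff r j • D ^ j) v - v‖ ≤ 4 * ‖D v‖ := by
  have hone : ∀ j : ℕ, |(if j = 0 then 1 else 0 : ℝ)| ≤ 1 := fun j => by split_ifs <;> simp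
  have h1 : (∑' j : ℕ, (if j = 0 then 1 else 0 : ℝ) • D ^ j) = 1 := by
    rw [tsum_eq_single 0 fun j hj => by simp [hj]]
    simp
  have h2 : (∑' j, truncBernoulliCoeff r j • D ^ j) v - v =
      (∑' j, (truncBernoulliCoeff r j - if j = 0 then 1 else 0) • D ^ j) v := by
    rw [← tsum_smul_pow_sub (abs_truncBernoulliCoeff_le_one r) hone (by linarith), h1]
    simp
  rw [h2]
  refine (norm_tsum_smul_pow_apply_le (fun j => ?_) 0 (fun j hj => ?_) hD v).trans (by norm_num)
  · split_ifs with h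
    · simp [h]
    · simpa using abs_truncBernoulliCoeff_le_one r j
  · simp [Nat.le_zero.1 hj]

/-- The truncation error of `dexp⁻¹_u (v)`: it is of order `p` as soon as `ad_u = O(τ)` and
`[u, v] = O(τ ^ 2)`, since all omitted terms contain at least `r + 1 ≥ p - 1` brackets, the
innermost of which is `[u, v]`. -/
theorem exists_norm_bernoulli_sub_trunc_le (r : ℕ∞) (p : ℕ) (hr : (p : ℕ∞) ≤ r + 2) {a b : ℝ}
    (ha : 0 ≤ a) (hb : 0 ≤ b) : ∃ C : ℝ, 0 ≤ C ∧ ∀ (τ : ℝ) (D : E →L[ℝ] E) (v : E), |τ| ≤ 1 →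
      ‖D‖ ≤ 1 / 2 → ‖D‖ ≤ a * |τ| → ‖D v‖ ≤ b * |τ| ^ 2 →
      ‖(∑' j, bernoulliCoeff j • D ^ j) v - (∑' j, truncBernoulliCoeff r j • D ^ j) v‖ ≤
        C * |τ| ^ p := by
  induction r using ENat.recTopCoe with
  | top =>
    refine ⟨0, le_rfl, fun τ D v _ _ _ _ => ?_⟩
    have : truncBernoulliCoeff ⊤ = bernoulliCoeff := by
      funext j
      simp [truncBernoulliCoeff]
    simp [this]
  | coe n =>
    have hpn : p ≤ n + 2 := by
      have : (p : ℕ∞) ≤ ((n + 2 : ℕ) : ℕ∞) := by simpa using hr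
      exact_mod_cast this
    refine ⟨2 ^ (n + 2) * a ^ n * b, by positivity, fun τ D v hτ hD hDa hDv => ?_⟩
    rw [← sub_apply, tsum_smul_pow_sub abs_bernoulliCoeff_le_one
      (abs_truncBernoulliCoeff_le_one _) (by linarith)]
    refine (norm_tsum_smul_pow_apply_le (fun j => ?_) n (fun j hj => ?_) hD v).trans ?_
    · unfold truncBernoulliCoeff
      split_ifs
      · simp
      · simpa using abs_bernoulliCoeff_le_one j
    · have : (j : ℕ∞) ≤ ((n : ℕ) : ℕ∞) := by exact_mod_cast hj
      unfold truncBernoulliCoeff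
      rw [if_pos this, sub_self]
    · calc 2 ^ (n + 2) * ‖D‖ ^ n * ‖D v‖ ≤ 2 ^ (n + 2) * (a * |τ|) ^ n * (b * |τ| ^ 2) := by
            gcongr
        _ = 2 ^ (n + 2) * a ^ n * b * |τ| ^ (n + 2) := by ring
        _ ≤ 2 ^ (n + 2) * a ^ n * b * |τ| ^ p := by
            gcongr 2 ^ (n + 2) * a ^ n * b * ?_
            exact pow_le_pow_of_le_one (abs_nonneg _) hτ hpn

end BracketSeries

/-! ### The exact flow on the Lie algebra -/

section Core

open NormedSpace

variable {E V : Type*} [NormedAddCommGroup E] [NormedSpace ℝ E]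
  [NormedAddCommGroup V] [NormedSpace ℝ V]

/-- A representation `σ` of a Lie algebra intertwines the powers of `ad` with those of the
commutator. -/
theorem map_ad_pow {ad : E →L[ℝ] E →L[ℝ] E} {σ : E →L[ℝ] V →L[ℝ] V}
    (hσ : ∀ u v, σ (ad u v) = σ u * σ v - σ v * σ u) (u v : E) (j : ℕ) :
    σ ((ad u ^ j) v) = (commutatorCLM (σ u) ^ j) (σ v) := by
  induction j with
  | zero => simp
  | succ j ih =>
    rw [pow_succ', pow_succ', mul_apply_eq_comp, mul_apply_eq_comp, hσ, ih, commutatorCLM_apply]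

variable [FiniteDimensional ℝ E] [FiniteDimensional ℝ V]

/-- The equation `u' = dexp⁻¹_u (v)` implies `(exp (σ u))' = σ v exp (σ u)`. -/
theorem fderiv_exp_map_bernoulli {ad : E →L[ℝ] E →L[ℝ] E} {σ : E →L[ℝ] V →L[ℝ] V}
    (hσ : ∀ u v, σ (ad u v) = σ u * σ v - σ v * σ u) {u : E} (hu : ‖ad u‖ < 1)
    (hu' : ‖commutatorCLM (σ u)‖ < 1) (v : E) :
    fderiv ℝ (exp : (V →L[ℝ] V) → V →L[ℝ] V) (σ u)
      (σ ((∑' j, bernoulliCoeff j • ad u ^ j) v)) = σ v * exp (σ u) := by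
  have hE := FiniteDimensional.complete ℝ E
  have hV := FiniteDimensional.complete ℝ V
  rw [← fderiv_exp_bernoulli hu']
  congr 1
  have h1 := σ.hasSum (hasSum_smul_pow_apply abs_bernoulliCoeff_le_one hu v)
  have h2 := hasSum_smul_pow_apply abs_bernoulliCoeff_le_one hu' (σ v)
  refine h1.unique (h2.congr_fun ?_)
  intro j
  simp only [map_smul, map_ad_pow hσ]

/-- If the exact flow `w = (u, m)` of the system `u' = dexp⁻¹_u (A (u, m))`, `m' = Xinv m`, with
the series of `dexp⁻¹` truncated at index `r ≥ p - 2`, starts at `(0, x)`, then `exp (σ u) m`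
approximates the flow of `Xtan + Xinv` starting at `x` up to an error of order `p + 1`. -/
theorem exists_flow_estimate {ad : E →L[ℝ] E →L[ℝ] E} {σ : E →L[ℝ] V →L[ℝ] V}
    (had : ∀ u, ad u u = 0) (hσ : ∀ u v, σ (ad u v) = σ u * σ v - σ v * σ u)
    {A : E × V → E} (hA : ContDiff ℝ ∞ A) {H : E × V → E × V} (hH : ContDiff ℝ ∞ H)
    {Xtan Xinv : V → V} (hXtan : ContDiff ℝ ∞ Xtan) (hXinv : ContDiff ℝ ∞ Xinv)
    {ρ : ℝ} (hρ : 0 < ρ) (r : ℕ∞) (p : ℕ) (hr : (p : ℕ∞) ≤ r + 2)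
    (hadρ : ∀ u ∈ Metric.closedBall (0 : E) ρ, ‖ad u‖ ≤ 1 / 2)
    (hσρ : ∀ u ∈ Metric.closedBall (0 : E) ρ, ‖commutatorCLM (σ u)‖ < 1)
    (hfst : ∀ u ∈ Metric.closedBall (0 : E) ρ, ∀ m,
      (H (u, m)).1 = (∑' j, truncBernoulliCoeff r j • ad u ^ j) (A (u, m)))
    (hsnd : ∀ q, (H q).2 = Xinv q.2)
    (hrel : ∀ u ∈ Metric.closedBall (0 : E) ρ, ∀ m,
      σ (A (u, m)) (exp (σ u) m) = Xtan (exp (σ u) m))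
    (hinv : ∀ u m, Xinv (exp (σ u) m) = exp (σ u) (Xinv m)) (x₀ : V) :
    ∃ C K : ℝ, ∀ᶠ q : ℝ × V in 𝓝 ((0 : ℝ), x₀), ∃ w : ℝ → E × V, w 0 = (0, q.2) ∧
      (∀ t ∈ Set.uIcc 0 q.1, HasDerivWithinAt w (H (w t)) (Set.uIcc 0 q.1) t) ∧
      ‖w q.1 - (0, q.2)‖ ≤ |q.1| * K ∧
      ∀ y : ℝ → V, y 0 = q.2 →
        (∀ t ∈ Set.uIcc 0 q.1, HasDerivWithinAt y (Xtan (y t) + Xinv (y t)) (Set.uIcc 0 q.1) t) →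
        ‖exp (σ (w q.1).1) (w q.1).2 - y q.1‖ ≤ C * |q.1| ^ (p + 1) := by
  have hE := FiniteDimensional.complete ℝ E
  have hV := FiniteDimensional.complete ℝ V
  have hW := FiniteDimensional.complete ℝ (E × V)
  have hWp := FiniteDimensional.proper ℝ (E × V)
  have hVp := FiniteDimensional.proper ℝ V
  set X : V → V := fun v => Xtan v + Xinv v with hXdef
  have hX : ContDiff ℝ ∞ X := hXtan.add hXinv
  have hexp : ContDiff ℝ ∞ (exp : (V →L[ℝ] V) → V →L[ℝ] V) := contDiff_normedSpace_exp
  -- a radius on which the field is given by the series and the images stay near `x₀`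
  obtain ⟨R, hR0, hRρ, hRx⟩ : ∃ R > 0, R ≤ ρ ∧ ∀ w ∈ Metric.closedBall ((0 : E), x₀) R,
      exp (σ w.1) w.2 ∈ Metric.closedBall x₀ 1 := by
    have hc : Continuous fun w : E × V => exp (σ w.1) w.2 :=
      (hexp.continuous.comp (σ.continuous.comp continuous_fst)).clm_apply continuous_snd
    have hev : ∀ᶠ w in 𝓝 ((0 : E), x₀), exp (σ w.1) w.2 ∈ Metric.closedBall x₀ 1 :=
      (hc.tendsto' (0, x₀) x₀ (by simp)).eventually (Metric.closedBall_mem_nhds x₀ one_pos)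
    obtain ⟨R', hR', h⟩ := Metric.eventually_nhds_iff_ball.1 hev
    refine ⟨min (R' / 2) ρ, by positivity, min_le_right _ _, fun w hw => h w ?_⟩
    have : dist w (0, x₀) ≤ R' / 2 := hw.trans (min_le_left _ _)
    rw [Metric.mem_ball]
    linarith
  set B := Metric.closedBall ((0 : E), x₀) R with hB
  obtain ⟨K, hK1, hK⟩ := exists_forall_closedBall_norm_le hH.continuous ((0 : E), x₀) R
  obtain ⟨KA, hKA1, hKA⟩ := exists_forall_closedBall_norm_le hA.continuous ((0 : E), x₀) R
  obtain ⟨LA, hLA⟩ := hA.contDiffOn.exists_lipschitzOnWith (by simp)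
    (convex_closedBall ((0 : E), x₀) R) (isCompact_closedBall _ _)
  obtain ⟨KX, hKX1, hKX⟩ := exists_forall_closedBall_norm_le hX.continuous x₀ 1
  obtain ⟨LX, hLX⟩ := hX.contDiffOn.exists_lipschitzOnWith (by simp)
    (convex_closedBall x₀ 1) (isCompact_closedBall _ _)
  obtain ⟨KE, hKE1, hKE⟩ := exists_forall_closedBall_norm_le
    (f := fun w : E × V => fderiv ℝ (exp : (V →L[ℝ] V) → V →L[ℝ] V) (σ w.1))
    ((hexp.continuous_fderiv (by simp)).comp (σ.continuous.comp continuous_fst)) ((0 : E), x₀) R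
  -- `C₁ τ ^ 2` bounds `u t - t τ v t`, `C₂ |τ| ^ p` the truncation error, and `C₃ |τ| ^ (p + 1)` the
  -- defect of `exp (σ u) m` in the differential equation
  set C₁ : ℝ := 4 * (‖ad‖ * K * KA) + LA * (2 * K) with hC₁
  have hC₁0 : 0 ≤ C₁ := by positivity
  obtain ⟨C₂, hC₂0, hC₂⟩ := exists_norm_bernoulli_sub_trunc_le (E := E) r p hr
    (a := ‖ad‖ * K) (b := ‖ad‖ * C₁ * KA) (by positivity) (by positivity)
  set C₃ : ℝ := KE * (‖σ‖ * C₂) * (‖x₀‖ + R) with hC₃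
  refine ⟨C₃ * gronwallBound 0 LX 1 1, K, ?_⟩
  have hnear : ∀ᶠ q : ℝ × V in 𝓝 ((0 : ℝ), x₀), dist q.2 x₀ < min (R / 2) (1 / 2) :=
    (continuous_snd.tendsto ((0 : ℝ), x₀)).eventually (Metric.ball_mem_nhds x₀ (by positivity))
  have hsol : ∀ᶠ q : ℝ × V in 𝓝 ((0 : ℝ), x₀), ∃ w : ℝ → E × V, w 0 = (0, q.2) ∧
      ∀ t ∈ Set.uIcc 0 q.1, HasDerivWithinAt w (H (w t)) (Set.uIcc 0 q.1) t := by
    have hc : Continuous fun q : ℝ × V => (q.1, ((0 : E), q.2)) := by fun_prop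
    exact (hc.tendsto' ((0 : ℝ), x₀) (0, (0, x₀)) rfl).eventually
      (exists_solution_uIcc (hH.of_le (by simp)) ((0 : E), x₀))
  filter_upwards [hnear, hsol, eventually_abs_mul_lt x₀ K (half_pos hR0),
    eventually_abs_mul_lt x₀ KX (half_pos one_pos), eventually_abs_mul_lt x₀ 1 one_pos]
    with ⟨τ, x⟩ hx ⟨w, hw0, hw⟩ hτK hτKX hτ1
  simp only at hx hw0 hw hτK hτKX hτ1 ⊢
  rw [mul_one] at hτ1
  -- pass to the time interval `[0, 1]`
  set w' : ℝ → E × V := fun t => w (t * τ) with hw'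
  have hw'd := hasDerivWithinAt_rescale hw
  have hw'0 : w' 0 = (0, x) := by simp [hw', hw0]
  have hdist : dist ((0 : E), x) ((0 : E), x₀) = dist x x₀ := by simp [Prod.dist_eq]
  have hsubB : Metric.closedBall ((0 : E), x) (R / 2) ⊆ B := by
    refine Metric.closedBall_subset_closedBall' ?_
    rw [hdist]
    linarith [hx.le.trans (min_le_left _ _)]
  have hsubX : Metric.closedBall x (1 / 2) ⊆ Metric.closedBall x₀ 1 := by
    refine Metric.closedBall_subset_closedBall' ?_
    linarith [hx.le.trans (min_le_right _ _)]
  have hw'near : ∀ t ∈ Set.Icc (0 : ℝ) 1, ‖w' t - (0, x)‖ ≤ |τ| * K :=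
    norm_sub_le_of_scaled_solution hw'0 (by linarith) (fun y hy => hK y (hsubB hy)) hw'd hτK
  have hw'B : ∀ t ∈ Set.Icc (0 : ℝ) 1, w' t ∈ B := fun t ht =>
    hsubB (mem_closedBall_iff_norm.2 ((hw'near t ht).trans hτK.le))
  have hone : (1 : ℝ) ∈ Set.Icc (0 : ℝ) 1 := by simp
  have hw'1 : w' 1 = w τ := by simp [hw']
  refine ⟨w, hw0, hw, by simpa [hw'1] using hw'near 1 hone, fun y hy0 hy => ?_⟩
  set y' : ℝ → V := fun t => y (t * τ) with hy'
  have hy'd : ∀ t ∈ Set.Icc (0 : ℝ) 1, HasDerivWithinAt y' (τ • X (y' t)) (Set.Icc 0 1) t :=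
    hasDerivWithinAt_rescale (X := X) hy
  have hy'0 : y' 0 = x := by simp [hy', hy0]
  have hy'S : ∀ t ∈ Set.Icc (0 : ℝ) 1, y' t ∈ Metric.closedBall x₀ 1 := fun t ht =>
    hsubX (mem_closedBall_iff_norm.2 ((norm_sub_le_of_scaled_solution hy'0 (by linarith)
      (fun v hv => hKX v (hsubX hv)) hy'd hτKX t ht).trans hτKX.le))
  -- components of the flow
  set u : ℝ → E := fun t => (w' t).1 with hu
  set v : ℝ → E := fun t => A (w' t) with hv
  have hud : ∀ t ∈ Set.Icc (0 : ℝ) 1, HasDerivWithinAt u (τ • (H (w' t)).1) (Set.Icc 0 1) t :=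
    fun t ht => (hw'd t ht).fst
  have hmd : ∀ t ∈ Set.Icc (0 : ℝ) 1,
      HasDerivWithinAt (fun t => (w' t).2) (τ • Xinv (w' t).2) (Set.Icc 0 1) t :=
    fun t ht => by
      have := (hw'd t ht).snd
      rw [← hsnd]
      exact this
  have huR : ∀ w ∈ B, w.1 ∈ Metric.closedBall (0 : E) ρ := fun w hw => by
    rw [mem_closedBall_iff_norm] at hw ⊢
    exact ((norm_fst_le (w - (0, x₀))).trans hw).trans hRρ
  have huτ : ∀ t ∈ Set.Icc (0 : ℝ) 1, ‖u t‖ ≤ |τ| * K := fun t ht => by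
    have := (norm_fst_le (w' t - (0, x))).trans (hw'near t ht)
    simpa using this
  have hHu : ∀ t ∈ Set.Icc (0 : ℝ) 1,
      (H (w' t)).1 = (∑' j, truncBernoulliCoeff r j • ad (u t) ^ j) (v t) := fun t ht =>
    hfst _ (huR _ (hw'B t ht)) _
  have hadu : ∀ t ∈ Set.Icc (0 : ℝ) 1, ‖ad (u t)‖ ≤ ‖ad‖ * K * |τ| := fun t ht => by
    calc _ ≤ ‖ad‖ * ‖u t‖ := ad.le_opNorm _
      _ ≤ ‖ad‖ * (|τ| * K) := by gcongr; exact huτ t ht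
      _ = _ := by ring
  have hvK : ∀ t ∈ Set.Icc (0 : ℝ) 1, ‖v t‖ ≤ KA := fun t ht => hKA _ (hw'B t ht)
  have hvL : ∀ t ∈ Set.Icc (0 : ℝ) 1, ∀ t' ∈ Set.Icc (0 : ℝ) 1,
      ‖v t - v t'‖ ≤ LA * (2 * K) * |τ| := fun t ht t' ht' => by
    have h1 := hLA.norm_sub_le (hw'B t ht) (hw'B t' ht')
    have h2 : ‖w' t - w' t'‖ ≤ 2 * K * |τ| := by
      have h3 := norm_sub_le (w' t - (0, x)) (w' t' - (0, x))
      rw [sub_sub_sub_cancel_right] at h3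
      linarith [hw'near t ht, hw'near t' ht']
    calc _ ≤ LA * ‖w' t - w' t'‖ := h1
      _ ≤ LA * (2 * K * |τ|) := by gcongr
      _ = _ := by ring
  -- `u t = t τ v t + O(τ ^ 2)`, hence `[u, v] = O(τ ^ 2)`
  have hbr : ∀ t ∈ Set.Icc (0 : ℝ) 1, ‖ad (u t) (v t)‖ ≤ ‖ad‖ * C₁ * KA * |τ| ^ 2 := by
    intro t ht
    set g : ℝ → E := fun t' => u t' - (t' * τ) • v t with hg
    have hgd : ∀ t' ∈ Set.Icc (0 : ℝ) 1,
        HasDerivWithinAt g (τ • ((H (w' t')).1 - v t)) (Set.Icc 0 1) t' := fun t' ht' => by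
      have h1 : HasDerivWithinAt (fun t' : ℝ => (t' * τ) • v t) (τ • v t) (Set.Icc 0 1) t' := by
        simpa using (((hasDerivAt_id t').mul_const τ).smul_const (v t)).hasDerivWithinAt
      rw [smul_sub]
      exact (hud t' ht').sub h1
    have hgb : ∀ t' ∈ Set.Icc (0 : ℝ) 1, ‖τ • ((H (w' t')).1 - v t)‖ ≤ C₁ * |τ| ^ 2 := by
      intro t' ht'
      have h1 : ‖(H (w' t')).1 - v t'‖ ≤ 4 * (‖ad‖ * K * KA) * |τ| := by
        rw [hHu t' ht']
        refine (norm_truncBernoulli_apply_sub_le r (hadρ _ (huR _ (hw'B t' ht'))) _).trans ?_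
        have : ‖ad (u t') (v t')‖ ≤ ‖ad‖ * K * |τ| * KA :=
          ((ad (u t')).le_opNorm _).trans
            (mul_le_mul (hadu t' ht') (hvK t' ht') (norm_nonneg _) (by positivity))
        linarith
      have h2 := hvL t' ht' t ht
      rw [norm_smul, Real.norm_eq_abs]
      have h3 : ‖(H (w' t')).1 - v t‖ ≤ C₁ * |τ| := by
        have := norm_sub_le_norm_sub_add_norm_sub (H (w' t')).1 (v t') (v t)
        rw [hC₁, add_mul]
        linarith
      calc _ ≤ |τ| * (C₁ * |τ|) := by gcongr
        _ = _ := by ring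
    have hg0 : g 0 = 0 := by simp [hg, hu, hw'0]
    have hgt : ‖g t‖ ≤ C₁ * |τ| ^ 2 := by
      have := (convex_Icc (0 : ℝ) 1).norm_image_sub_le_of_norm_hasDerivWithin_le hgd hgb
        (by simp : (0 : ℝ) ∈ Set.Icc (0 : ℝ) 1) ht
      rw [hg0, sub_zero, sub_zero, Real.norm_eq_abs, abs_of_nonneg ht.1] at this
      exact this.trans (mul_le_of_le_one_right (by positivity) ht.2)
    have hadg : ad (u t) (v t) = ad (g t) (v t) := by
      simp [hg, had]
    rw [hadg]
    calc _ ≤ ‖ad‖ * ‖g t‖ * ‖v t‖ := ad.le_opNorm₂ _ _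
      _ ≤ ‖ad‖ * (C₁ * |τ| ^ 2) * KA := by gcongr; exact hvK t ht
      _ = _ := by ring
  -- `z` solves the equation up to the defect `e` caused by the truncation error `q`
  set q : ℝ → E := fun t => (∑' j, bernoulliCoeff j • ad (u t) ^ j) (v t) -
    (∑' j, truncBernoulliCoeff r j • ad (u t) ^ j) (v t) with hq
  set z : ℝ → V := fun t => exp (σ (u t)) (w' t).2 with hz
  set e : ℝ → V := fun t =>
    -(τ • fderiv ℝ (exp : (V →L[ℝ] V) → V →L[ℝ] V) (σ (u t)) (σ (q t)) (w' t).2) with he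
  have hzd : ∀ t ∈ Set.Icc (0 : ℝ) 1,
      HasDerivWithinAt z (τ • X (z t) + e t) (Set.Icc 0 1) t := by
    intro t ht
    have hσu := σ.hasFDerivAt.comp_hasDerivWithinAt t (hud t ht)
    have hEu := ((hexp.differentiable (by simp)) (σ (u t))).hasFDerivAt.comp_hasDerivWithinAt t
      (f := fun t => σ (u t)) hσu
    refine (hEu.clm_apply (hmd t ht)).congr_deriv ?_
    have huB := huR _ (hw'B t ht)
    have h1 := fderiv_exp_map_bernoulli hσ (u := u t)
      ((hadρ _ huB).trans_lt (by norm_num)) (hσρ _ huB) (v t)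
    have h2 : (H (w' t)).1 = (∑' j, bernoulliCoeff j • ad (u t) ^ j) (v t) - q t := by
      rw [hHu t ht, hq]
      simp
    have h3 : σ (v t) (exp (σ (u t)) (w' t).2) = Xtan (exp (σ (u t)) (w' t).2) :=
      hrel (u t) huB (w' t).2
    rw [h2]
    simp only [map_smul, map_sub, h1, smul_apply, sub_apply, mul_apply_eq_comp, h3, hz, he, hXdef,
      hinv, Function.comp_apply]
    module
  have heb : ∀ t ∈ Set.Icc (0 : ℝ) 1, ‖e t‖ ≤ C₃ * |τ| ^ (p + 1) := by
    intro t ht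
    have h1 : ‖q t‖ ≤ C₂ * |τ| ^ p := hC₂ τ (ad (u t)) (v t) hτ1.le (hadρ _ (huR _ (hw'B t ht)))
      (hadu t ht) (hbr t ht)
    have h2 : ‖(w' t).2‖ ≤ ‖x₀‖ + R := by
      have h3 := hw'B t ht
      rw [hB, mem_closedBall_iff_norm] at h3
      have h4 : ‖(w' t).2 - x₀‖ ≤ R := (norm_snd_le (w' t - (0, x₀))).trans h3
      have h5 := norm_le_norm_add_norm_sub' (w' t).2 x₀
      linarith
    have h3 := hKE _ (hw'B t ht)
    simp only [he, norm_neg, norm_smul, Real.norm_eq_abs]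
    have h4 : ‖fderiv ℝ (exp : (V →L[ℝ] V) → V →L[ℝ] V) (σ (u t)) (σ (q t)) (w' t).2‖ ≤
        KE * (‖σ‖ * (C₂ * |τ| ^ p)) * (‖x₀‖ + R) := by
      refine (ContinuousLinearMap.le_opNorm _ _).trans ?_
      refine mul_le_mul ?_ h2 (norm_nonneg _) (by positivity)
      refine (ContinuousLinearMap.le_opNorm _ _).trans ?_
      refine mul_le_mul h3 ?_ (norm_nonneg _) (by positivity)
      exact (σ.le_opNorm _).trans (mul_le_mul_of_nonneg_left h1 (norm_nonneg _))
    calc _ ≤ |τ| * (KE * (‖σ‖ * (C₂ * |τ| ^ p)) * (‖x₀‖ + R)) := by gcongr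
      _ = _ := by rw [hC₃]; ring
  have hz0 : z 0 = y' 0 := by simp [hz, hu, hw'0, hy'0]
  have main : ‖z 1 - y' 1‖ ≤ _ := norm_sub_le_of_scaled_approx hLX hτ1.le hy'S (fun t ht => hRx _ (hw'B t ht)) hz0
    hy'd hzd heb
  have hz1 : z 1 = exp (σ (w τ).1) (w τ).2 := by simp [hz, hu, hw'1]
  have hy1 : y' 1 = y τ := by simp [hy']
  rw [hz1, hy1] at main
  refine main.trans (le_of_eq ?_)
  ring

end Core

/-! ### Order of the combined method in a vector space -/

section LinearizedMethod

open NormedSpace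

variable {E V : Type*} [NormedAddCommGroup E] [NormedSpace ℝ E]
  [NormedAddCommGroup V] [NormedSpace ℝ V] {s : ℕ}

/-- The combined Runge-Kutta / Runge-Kutta-Munthe-Kaas step, written in a vector space `E` with a
bracket `ad` and a representation `σ` on `V` instead of a Lie group: the group element `exp u`
acts on `V` as the operator exponential of `σ u`, and `A (u, m)` stands for `A (exp u, m)`. -/
def AlgebraStep (T : ButcherTableau s) (r : ℕ∞) (ad : E →L[ℝ] E →L[ℝ] E)
    (σ : E →L[ℝ] V →L[ℝ] V) (A : E × V → E) (Y : V → V) (τ : ℝ) (x x' : V) : Prop :=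
  ∃ (M : ℝ → Fin s → V) (U : ℝ → Fin s → E), T.StageBranch Y τ x M ∧
    (ContinuousOn U (Set.uIcc 0 τ) ∧ ∀ t ∈ Set.uIcc 0 τ,
      (∀ j, Summable fun k => truncBernoulliCoeff r k • (ad (U t j) ^ k) (A (U t j, M t j))) ∧
      ∀ i, U t i = t • ∑ j, T.a i j •
        ∑' k, truncBernoulliCoeff r k • (ad (U t j) ^ k) (A (U t j, M t j))) ∧
    x' = exp (σ (τ • ∑ i, T.b i •
      ∑' k, truncBernoulliCoeff r k • (ad (U τ i) ^ k) (A (U τ i, M τ i))))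
        (T.update Y τ x (M τ))

variable [FiniteDimensional ℝ E] [FiniteDimensional ℝ V]

/-- The combined method has the order of the underlying Runge-Kutta method: for small step sizes
it is the image of the Runge-Kutta method for `u' = dexp⁻¹_u (A (u, m))`, `m' = Y m` under the map
`(u, m) ↦ exp (σ u) m`. -/
theorem isIntegratorOfOrder_algebraStep {ad : E →L[ℝ] E →L[ℝ] E} {σ : E →L[ℝ] V →L[ℝ] V}
    (had : ∀ u, ad u u = 0) (hσ : ∀ u v, σ (ad u v) = σ u * σ v - σ v * σ u)
    {A : E × V → E} {ε : ℝ} (hε : 0 < ε) (hA : ContDiffOn ℝ ∞ A (Metric.ball 0 ε ×ˢ Set.univ))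
    {Xtan Xinv : V → V} (hXtan : ContDiff ℝ ∞ Xtan) (hXinv : ContDiff ℝ ∞ Xinv)
    {p : ℕ} {T : ButcherTableau s} (hT : T.HasOrder p) {r : ℕ∞} (hr : (p : ℕ∞) ≤ r + 2)
    (hrel : ∀ u m, σ (A (u, m)) (exp (σ u) m) = Xtan (exp (σ u) m))
    (hinv : ∀ u m, Xinv (exp (σ u) m) = exp (σ u) (Xinv m)) :
    IsIntegratorOfOrder p (AlgebraStep T r ad σ A Xinv) (fun x => Xtan x + Xinv x) := by
  have hE := FiniteDimensional.complete ℝ E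
  have hV := FiniteDimensional.complete ℝ V
  intro x₀
  -- extend `A` and the field `dexp⁻¹_u (A (u, m))` to smooth maps on the whole space
  obtain ⟨A', hA', hAA'⟩ := exists_contDiff_eq_of_contDiffOn_ball hε hA
  set ε' : ℝ := 1 / (‖ad‖ + 1) with hε'
  have hε'0 : 0 < ε' := by positivity
  have hadε : ∀ u : E, ‖u‖ < ε' → ‖ad u‖ < 1 := fun u hu => by
    calc ‖ad u‖ ≤ ‖ad‖ * ‖u‖ := ad.le_opNorm u
      _ ≤ ‖ad‖ * ε' := by gcongr
      _ < 1 := by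
        rw [hε', mul_one_div, div_lt_one (by positivity)]
        linarith
  obtain ⟨F, hF, hFf⟩ := exists_contDiff_eq_of_contDiffOn_ball (E := E) (V := V) hε'0
    (f := fun q => (∑' j, truncBernoulliCoeff r j • ad q.1 ^ j) (A' q)) (by
      refine ContDiffOn.clm_apply (E := E × V) ?_ hA'.contDiffOn
      refine (contDiffOn_tsum_smul_pow (abs_truncBernoulliCoeff_le_one r)).comp
        (ad.contDiff.comp contDiff_fst).contDiffOn fun q hq => ?_
      have := hadε q.1 (by simpa using hq.1)
      simpa using this)
  set ρ : ℝ := min (ε / 2) (min (ε' / 2) (1 / (4 * (‖σ‖ + 1)))) with hρdef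
  have hρ0 : 0 < ρ := by positivity
  have hρε : ρ ≤ ε / 2 := min_le_left _ _
  have hρε' : ρ ≤ ε' / 2 := (min_le_right _ _).trans (min_le_left _ _)
  have hρσ : ρ ≤ 1 / (4 * (‖σ‖ + 1)) := (min_le_right _ _).trans (min_le_right _ _)
  have hadρ : ∀ u ∈ Metric.closedBall (0 : E) ρ, ‖ad u‖ ≤ 1 / 2 := fun u hu => by
    have hu' : ‖u‖ ≤ ρ := by simpa using hu
    calc ‖ad u‖ ≤ ‖ad‖ * ‖u‖ := ad.le_opNorm u
      _ ≤ ‖ad‖ * (ε' / 2) := by gcongr; exact hu'.trans hρε'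
      _ ≤ (‖ad‖ + 1) * (ε' / 2) := by gcongr; linarith
      _ = 1 / 2 := by rw [hε']; field_simp
  have hσρ : ∀ u ∈ Metric.closedBall (0 : E) ρ, ‖commutatorCLM (σ u)‖ < 1 := fun u hu => by
    have hu' : ‖u‖ ≤ ρ := by simpa using hu
    calc _ ≤ 2 * ‖σ u‖ := norm_commutatorCLM_le _
      _ ≤ 2 * (‖σ‖ * ‖u‖) := by gcongr; exact σ.le_opNorm u
      _ ≤ 2 * ((‖σ‖ + 1) * (1 / (4 * (‖σ‖ + 1)))) := by
          gcongr
          · linarith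
          · exact hu'.trans hρσ
      _ = 1 / 2 := by field_simp; norm_num
      _ < 1 := by norm_num
  have hAρ : ∀ u ∈ Metric.closedBall (0 : E) ρ, ∀ m, A' (u, m) = A (u, m) := fun u hu m =>
    hAA' u (Metric.closedBall_subset_closedBall hρε hu) m
  have hFρ : ∀ u ∈ Metric.closedBall (0 : E) ρ, ∀ m,
      F (u, m) = (∑' j, truncBernoulliCoeff r j • ad u ^ j) (A' (u, m)) := fun u hu m =>
    hFf u (Metric.closedBall_subset_closedBall hρε' hu) m
  have hsum : ∀ u ∈ Metric.closedBall (0 : E) ρ, ∀ m,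
      HasSum (fun k => truncBernoulliCoeff r k • (ad u ^ k) (A (u, m))) (F (u, m)) :=
    fun u hu m => by
      rw [hFρ u hu m, hAρ u hu m]
      exact hasSum_smul_pow_apply (abs_truncBernoulliCoeff_le_one r)
        ((hadρ u hu).trans_lt (by norm_num)) _
  set H : E × V → E × V := fun q => (F q, Xinv q.2) with hHdef
  have hH : ContDiff ℝ ∞ H := hF.prodMk (hXinv.comp contDiff_snd)
  set f : E × V → E := fun q => ∑' k, truncBernoulliCoeff r k • (ad q.1 ^ k) (A q) with hf
  have hstage := eventually_stageBranch_iff T (f := f) hρ0 hXinv hH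
    (fun u hu m => (hsum u hu m).tsum_eq.symm) (fun _ => rfl) x₀
  obtain ⟨CF, K, hflow⟩ := exists_flow_estimate had hσ hA' hH hXtan hXinv hρ0 r p hr hadρ hσρ
    hFρ (fun _ => rfl) (fun u hu m => by rw [hAρ u hu m]; exact hrel u m) hinv x₀
  obtain ⟨CH, hCH⟩ := hT.isIntegratorOfOrder hH ((0 : E), x₀)
  have hcH : Continuous fun q : ℝ × V => (q.1, ((0 : E), q.2)) := by fun_prop
  have hCH' := (hcH.tendsto' ((0 : ℝ), x₀) (0, (0, x₀)) rfl).eventually hCH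
  -- the map `(u, m) ↦ exp (σ u) m` is locally Lipschitz
  set Θ : E × V → V := fun q => exp (σ q.1) q.2 with hΘ
  have hΘc : ContDiff ℝ 1 Θ :=
    (contDiff_normedSpace_exp.comp (σ.contDiff.comp contDiff_fst)).clm_apply contDiff_snd
  obtain ⟨L, N, hN, hL⟩ := hΘc.contDiffAt.exists_lipschitzOnWith (x := ((0 : E), x₀))
  obtain ⟨δ, hδ, hδN⟩ := Metric.mem_nhds_iff.1 hN
  refine ⟨L * CH + CF, ?_⟩
  have hnear : ∀ᶠ q : ℝ × V in 𝓝 ((0 : ℝ), x₀), dist q.2 x₀ < δ / 3 :=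
    (continuous_snd.tendsto ((0 : ℝ), x₀)).eventually (Metric.ball_mem_nhds x₀ (by positivity))
  have hδ3 : 0 < δ / 3 := by positivity
  filter_upwards [hstage, hflow, hCH', hnear, eventually_abs_mul_lt x₀ K hδ3,
    eventually_abs_mul_lt x₀ |CH| hδ3, eventually_abs_mul_lt x₀ 1 one_pos]
    with ⟨τ, x⟩ hst ⟨w, hw0, hw, hwK, hwy⟩ ⟨⟨x₁, hx₁⟩, herr⟩ hx hτK hτC hτ1
  simp only at hst hw0 hw hwK hwy hx₁ herr hx hτK hτC hτ1 ⊢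
  rw [mul_one] at hτ1
  constructor
  · obtain ⟨Z, hZ, -⟩ := hx₁
    obtain ⟨h1, h2, h3⟩ := hst.2 Z hZ
    exact ⟨_, _, _, h1, ⟨h2, fun t ht => ⟨fun j =>
      (hsum _ (by simpa using (h3 t ht).1 j) _).summable, (h3 t ht).2⟩⟩, rfl⟩
  · rintro x' ⟨M, U, hM, ⟨hUc, hU⟩, rfl⟩ y hy0 hy
    have hstep := hst.1 M U hM hUc fun t ht => (hU t ht).2
    set q₁ : E × V := (τ • ∑ i, T.b i • f (U τ i, M τ i), T.update Xinv τ x (M τ)) with hq₁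
    change ‖Θ q₁ - y τ‖ ≤ _
    have h1 : ‖q₁ - w τ‖ ≤ CH * |τ| ^ (p + 1) := herr q₁ hstep w hw0 hw
    have h2 : ‖Θ (w τ) - y τ‖ ≤ CF * |τ| ^ (p + 1) := hwy y hy0 hy
    have hpow : |τ| ^ (p + 1) ≤ |τ| := by
      rw [pow_succ]
      exact mul_le_of_le_one_left (abs_nonneg _) (pow_le_one₀ (abs_nonneg _) hτ1.le)
    have h3 : ‖q₁ - w τ‖ < δ / 3 := by
      refine lt_of_le_of_lt (h1.trans ?_) hτC
      calc CH * |τ| ^ (p + 1) ≤ |CH| * |τ| := by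
            gcongr
            exact le_abs_self _
        _ = |τ| * |CH| := mul_comm _ _
    have h4 : dist (w τ) ((0 : E), x₀) < 2 * (δ / 3) := by
      have : dist ((0 : E), x) ((0 : E), x₀) = dist x x₀ := by simp [Prod.dist_eq]
      have h5 := dist_triangle (w τ) ((0 : E), x) ((0 : E), x₀)
      rw [dist_eq_norm (w τ) ((0 : E), x), this] at h5
      linarith
    have hwN : w τ ∈ N := hδN (by rw [Metric.mem_ball]; linarith)
    have hqN : q₁ ∈ N := hδN (by
      rw [Metric.mem_ball]
      have h5 := dist_triangle q₁ (w τ) ((0 : E), x₀)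
      rw [dist_eq_norm q₁ (w τ)] at h5
      linarith)
    have h5 : ‖Θ q₁ - Θ (w τ)‖ ≤ L * (CH * |τ| ^ (p + 1)) :=
      (hL.norm_sub_le hqN hwN).trans (mul_le_mul_of_nonneg_left h1 L.2)
    calc ‖Θ q₁ - y τ‖ ≤ ‖Θ q₁ - Θ (w τ)‖ + ‖Θ (w τ) - y τ‖ :=
          norm_sub_le_norm_sub_add_norm_sub _ _ _
      _ ≤ L * (CH * |τ| ^ (p + 1)) + CF * |τ| ^ (p + 1) := add_le_add h5 h2
      _ = _ := by ring

end LinearizedMethod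

/-! ### Smooth dependence of solutions on parameters -/

universe u

section Superposition

variable {K : Type*} [TopologicalSpace K] [CompactSpace K]

/-- Pointwise application of a continuous family of operators to a continuous function, as a
continuous bilinear map. -/
def pointwiseApplyCLM (K E F : Type*) [TopologicalSpace K] [CompactSpace K]
    [NormedAddCommGroup E] [NormedSpace ℝ E] [NormedAddCommGroup F] [NormedSpace ℝ F] :
    C(K, E →L[ℝ] F) →L[ℝ] C(K, E) →L[ℝ] C(K, F) :=
  LinearMap.mkContinuous₂
    (LinearMap.mk₂ ℝ (fun (T : C(K, E →L[ℝ] F)) (γ : C(K, E)) =>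
        (⟨fun k => T k (γ k), by fun_prop⟩ : C(K, F)))
      (fun _ _ _ => by ext; simp) (fun _ _ _ => by ext; simp)
      (fun _ _ _ => by ext; simp) (fun _ _ _ => by ext; simp)) 1
    (fun T γ => by
      rw [one_mul]
      refine (ContinuousMap.norm_le _ (by positivity)).2 fun k => ?_
      exact (ContinuousLinearMap.le_opNorm _ _).trans (mul_le_mul (T.norm_coe_le_norm k)
        (γ.norm_coe_le_norm k) (norm_nonneg (γ k)) (norm_nonneg T)))

/-- The superposition operator `γ ↦ f ∘ γ` of a `C¹` map is differentiable, with derivative given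
by the superposition operator of `f'`. -/
theorem hasFDerivAt_postcomp {E F : Type*} [NormedAddCommGroup E] [NormedSpace ℝ E]
    [NormedAddCommGroup F] [NormedSpace ℝ F] (f : C(E, F)) (f' : C(E, E →L[ℝ] F))
    (hf : ∀ x, HasFDerivAt f (f' x) x) (γ₀ : C(K, E)) :
    HasFDerivAt (fun γ : C(K, E) => f.comp γ) (pointwiseApplyCLM K E F (f'.comp γ₀)) γ₀ := by
  refine .of_isLittleO <| Asymptotics.isLittleO_iff.2 fun c hc => ?_
  have hcont : Continuous fun γ : C(K, E) => f'.comp γ := f'.continuous_postcomp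
  obtain ⟨δ, hδ, hδc⟩ := Metric.eventually_nhds_iff_ball.1
    ((hcont.tendsto γ₀).eventually (Metric.ball_mem_nhds (f'.comp γ₀) hc))
  filter_upwards [Metric.ball_mem_nhds γ₀ hδ] with γ hγ
  refine (ContinuousMap.norm_le _ (by positivity)).2 fun k => ?_
  have hb : ∀ x ∈ Metric.ball (γ₀ k) δ, ‖f' x - f' (γ₀ k)‖ ≤ c := fun x hx => by
    -- the bound at a single point follows from the bound for a constant perturbation of `γ₀`
    have h1 := hδc (γ₀ + ContinuousMap.const K (x - γ₀ k)) (by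
      rw [Metric.mem_ball, dist_self_add_left]
      refine lt_of_le_of_lt ((ContinuousMap.norm_le _ (norm_nonneg (x - γ₀ k))).2 fun _ => le_rfl) ?_
      simpa [dist_eq_norm] using hx)
    have h2 := (ContinuousMap.dist_apply_le_dist k).trans (Metric.mem_ball.1 h1).le
    simpa [dist_eq_norm] using h2
  have hmem : γ k ∈ Metric.ball (γ₀ k) δ :=
    lt_of_le_of_lt (ContinuousMap.dist_apply_le_dist k) hγ
  refine ((convex_ball (γ₀ k) δ).norm_image_sub_le_of_norm_hasFDerivWithin_le'
    (fun x _ => (hf x).hasFDerivWithinAt) hb (Metric.mem_ball_self hδ) hmem).trans ?_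
  exact mul_le_mul_of_nonneg_left ((γ - γ₀).norm_coe_le_norm k) hc.le

theorem contDiff_postcomp_nat {E : Type u} [NormedAddCommGroup E] [NormedSpace ℝ E] (n : ℕ) :
    ∀ {F : Type u} [NormedAddCommGroup F] [NormedSpace ℝ F] (f : C(E, F)), ContDiff ℝ n f →
      ContDiff ℝ n (fun γ : C(K, E) => f.comp γ) := by
  induction n with
  | zero => exact fun f _ => contDiff_zero.2 f.continuous_postcomp
  | succ n ih =>
    intro F _ _ f hf
    obtain ⟨f', hf', hff'⟩ := contDiff_succ_iff_hasFDerivAt.1 hf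
    let f'C : C(E, E →L[ℝ] F) := ⟨f', hf'.continuous⟩
    have h : ContDiff ℝ n fun γ : C(K, E) => pointwiseApplyCLM K E F (f'C.comp γ) :=
      contDiff_const.clm_apply (ih f'C hf')
    exact contDiff_succ_iff_hasFDerivAt.2 ⟨_, h, fun γ => hasFDerivAt_postcomp f f'C hff' γ⟩

/-- The superposition operator `γ ↦ f ∘ γ` of a smooth map is smooth. -/
theorem contDiff_postcomp {E F : Type u} [NormedAddCommGroup E] [NormedSpace ℝ E]
    [NormedAddCommGroup F] [NormedSpace ℝ F] (f : C(E, F)) (hf : ContDiff ℝ ∞ f) :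
    ContDiff ℝ ∞ (fun γ : C(K, E) => f.comp γ) :=
  contDiff_infty.2 fun n => contDiff_postcomp_nat n f (contDiff_infty.1 hf n)

end Superposition

section Picard

open Set

theorem continuous_extend {E : Type*} [TopologicalSpace E] (g : C(Icc (-2 : ℝ) 2, E)) :
    Continuous fun s : ℝ => g (projIcc (-2) 2 (by norm_num) s) :=
  g.continuous.comp continuous_projIcc

variable {E : Type u} [NormedAddCommGroup E] [NormedSpace ℝ E]

/-- The primitive `t ↦ ∫₀ᵗ g` of a continuous function on `[-2, 2]`, extended by constants to the
real line before integration. -/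
def primitiveIcc (g : C(Icc (-2 : ℝ) 2, E)) (t : ℝ) : E :=
  ∫ s in (0 : ℝ)..t, g (projIcc (-2) 2 (by norm_num) s)

theorem hasDerivAt_primitiveIcc [CompleteSpace E] (g : C(Icc (-2 : ℝ) 2, E)) (t : ℝ) :
    HasDerivAt (primitiveIcc g) (g (projIcc (-2) 2 (by norm_num) t)) t :=
  (continuous_extend g).integral_hasStrictDerivAt 0 t |>.hasDerivAt

theorem continuous_primitiveIcc (g : C(Icc (-2 : ℝ) 2, E)) : Continuous (primitiveIcc g) :=
  intervalIntegral.continuous_primitive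
    (fun _ _ => (continuous_extend g).intervalIntegrable _ _) 0

/-- The integration operator `g ↦ ∫₀ g` on `C([-2, 2], E)`. -/
def primitiveCLM (E : Type u) [NormedAddCommGroup E] [NormedSpace ℝ E] :
    C(Icc (-2 : ℝ) 2, E) →L[ℝ] C(Icc (-2 : ℝ) 2, E) :=
  LinearMap.mkContinuous
    { toFun := fun g => ⟨fun t => primitiveIcc g t,
        (continuous_primitiveIcc g).comp continuous_subtype_val⟩
      map_add' := fun g h => by
        ext t
        exact intervalIntegral.integral_add ((continuous_extend g).intervalIntegrable _ _)
          ((continuous_extend h).intervalIntegrable _ _)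
      map_smul' := fun c g => by
        ext t
        exact intervalIntegral.integral_smul c _ } 2
    (fun g => by
      refine (ContinuousMap.norm_le _ (by positivity)).2 fun t => ?_
      refine (intervalIntegral.norm_integral_le_of_norm_le_const
        fun s _ => g.norm_coe_le_norm _).trans ?_
      rw [mul_comm]
      refine mul_le_mul_of_nonneg_right ?_ (norm_nonneg g)
      rw [sub_zero]
      exact abs_le.2 t.2)

/-- The inclusion of `E` into `C(K, E)` as the constant functions. -/
def constCLM (K E : Type*) [TopologicalSpace K] [CompactSpace K]
    [NormedAddCommGroup E] [NormedSpace ℝ E] : E →L[ℝ] C(K, E) :=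
  LinearMap.mkContinuous
    { toFun := fun x => ContinuousMap.const K x
      map_add' := fun _ _ => rfl
      map_smul' := fun _ _ => rfl } 1
    (fun x => by
      rw [one_mul]
      exact (ContinuousMap.norm_le _ (norm_nonneg x)).2 fun _ => le_rfl)

/-- The solutions of `γ' = L(γ) ξ`, `γ(0) = 0` exist on a neighbourhood of `[-1, 1]` when `ξ` is
small, stay small, and depend smoothly on `ξ`: the inverse function theorem is applied to the Picard
map `(ξ, γ) ↦ (ξ, γ - ∫₀ L(γ) ξ)` of `E × C([-2, 2], E)`. -/
theorem exists_solution_contDiffOn [CompleteSpace E] {L : E → E →L[ℝ] E} (hL : ContDiff ℝ ∞ L)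
    {δ : ℝ} (hδ : 0 < δ) :
    ∃ ε > 0, ∃ Γ : E → ℝ → E,
      (∀ ξ ∈ Metric.ball (0 : E) ε, Γ ξ 0 = 0 ∧ ∀ t ∈ Ioo (-2 : ℝ) 2, ‖Γ ξ t‖ < δ ∧
        HasDerivAt (Γ ξ) (L (Γ ξ t) ξ) t) ∧
      ContDiffOn ℝ ∞ (fun ξ => Γ ξ 1) (Metric.ball 0 ε) := by
  let K := Icc (-2 : ℝ) 2
  let LC : C(E, E →L[ℝ] E) := ⟨L, hL.continuous⟩
  -- the right-hand side `L(γ) ξ`, as a function of time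
  let W : E × C(K, E) → C(K, E) := fun q => pointwiseApplyCLM K E E (LC.comp q.2) (constCLM K E q.1)
  let N : C(K, E) → E →L[ℝ] C(K, E) := fun γ =>
    (primitiveCLM E).comp ((pointwiseApplyCLM K E E (LC.comp γ)).comp (constCLM K E))
  have hN : ContDiff ℝ ∞ N := contDiff_const.clm_comp
    (((pointwiseApplyCLM K E E).contDiff.comp (contDiff_postcomp LC hL)).clm_comp contDiff_const)
  let Φ : E × C(K, E) → E × C(K, E) := fun q => (q.1, q.2 - N q.2 q.1)
  have hΦ : ContDiff ℝ ∞ Φ :=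
    contDiff_fst.prodMk (contDiff_snd.sub ((hN.comp contDiff_snd).clm_apply contDiff_fst))
  let D : (E × C(K, E)) ≃L[ℝ] (E × C(K, E)) :=
    (ContinuousLinearEquiv.refl ℝ E).skewProd (ContinuousLinearEquiv.refl ℝ C(K, E)) (-(N 0))
  have hD : HasFDerivAt Φ (D : (E × C(K, E)) →L[ℝ] (E × C(K, E))) 0 := by
    have hN0 : HasFDerivAt N (fderiv ℝ N 0) ((0 : E × C(K, E)).2) :=
      (hN.differentiable (by simp)).differentiableAt.hasFDerivAt
    have hN1 : HasFDerivAt (fun q : E × C(K, E) => N q.2)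
        ((fderiv ℝ N 0).comp (ContinuousLinearMap.snd ℝ E C(K, E))) 0 :=
      HasFDerivAt.comp (g := N) (0 : E × C(K, E)) hN0
        (hasFDerivAt_snd (𝕜 := ℝ) (p := (0 : E × C(K, E))))
    have h1 := hN1.clm_apply
      (hasFDerivAt_fst (𝕜 := ℝ) (p := (0 : E × C(K, E))))
    have h2 := (hasFDerivAt_fst (𝕜 := ℝ) (p := (0 : E × C(K, E)))).prodMk
      ((hasFDerivAt_snd (𝕜 := ℝ) (p := (0 : E × C(K, E)))).sub h1)
    refine h2.congr_fderiv ?_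
    refine ContinuousLinearMap.ext fun q => Prod.ext rfl ?_
    simp [D, sub_eq_add_neg]
  let ψ := (hΦ.contDiffAt (x := 0)).toOpenPartialHomeomorph Φ hD (by simp)
  have hΦ0 : Φ 0 = 0 := by simp [Φ]
  have hψ : ∀ q, ψ q = Φ q := fun q => rfl
  have h0s : (0 : E × C(K, E)) ∈ ψ.source :=
    (hΦ.contDiffAt (x := 0)).mem_toOpenPartialHomeomorph_source hD (by simp)
  have h0t : (0 : E × C(K, E)) ∈ ψ.target := by
    simpa [hψ, hΦ0] using ψ.map_source h0s
  have h0 : ψ.symm 0 = 0 := by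
    have := ψ.left_inv h0s
    rwa [hψ, hΦ0] at this
  have hcont : ContinuousAt ψ.symm 0 := ψ.continuousAt_symm h0t
  have hev : ∀ᶠ y in 𝓝 (0 : E × C(K, E)), y ∈ ψ.target ∧ ‖(ψ.symm y).2‖ < δ ∧
      fderiv ℝ Φ (ψ.symm y) ∈ range ((↑) : ((E × C(K, E)) ≃L[ℝ] (E × C(K, E))) → _) := by
    refine Filter.Eventually.and (ψ.open_target.mem_nhds h0t) (.and ?_ ?_)
    · refine (hcont.snd.norm).eventually_lt_const ?_
      simpa [h0] using hδ
    · have hc2 : ContinuousAt (fun y => fderiv ℝ Φ (ψ.symm y)) 0 :=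
        ((hΦ.continuous_fderiv (by simp)).continuousAt).comp hcont
      refine hc2.eventually_mem (ContinuousLinearEquiv.isOpen.mem_nhds ⟨D, ?_⟩)
      simp only [h0]
      exact hD.fderiv.symm
  have hev2 : ∀ᶠ ξ in 𝓝 (0 : E), (ξ, (0 : C(K, E))) ∈ ψ.target ∧ ‖(ψ.symm (ξ, 0)).2‖ < δ ∧
      fderiv ℝ Φ (ψ.symm (ξ, 0)) ∈
        range ((↑) : ((E × C(K, E)) ≃L[ℝ] (E × C(K, E))) → _) := by
    have : Filter.Tendsto (fun ξ : E => (ξ, (0 : C(K, E)))) (𝓝 0) (𝓝 0) := by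
      have h : Continuous fun ξ : E => (ξ, (0 : C(K, E))) := by fun_prop
      exact h.tendsto 0
    exact this.eventually hev
  obtain ⟨ε, hε, hball⟩ := Metric.eventually_nhds_iff_ball.1 hev2
  have h1K : (1 : ℝ) ∈ K := ⟨by norm_num, by norm_num⟩
  let γ : E → C(K, E) := fun ξ => (ψ.symm (ξ, 0)).2
  let Γ : E → ℝ → E := fun ξ => primitiveIcc (W (ξ, γ ξ))
  have hγ : ∀ ξ ∈ Metric.ball (0 : E) ε, γ ξ = primitiveCLM E (W (ξ, γ ξ)) := fun ξ hξ => by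
    have h := ψ.right_inv (hball ξ hξ).1
    rw [hψ] at h
    have h1 : (ψ.symm (ξ, 0)).1 = ξ := congrArg Prod.fst h
    have h2 : γ ξ - N (γ ξ) (ψ.symm (ξ, 0)).1 = 0 := congrArg Prod.snd h
    rw [h1] at h2
    exact sub_eq_zero.1 h2
  have hΓ : ∀ ξ ∈ Metric.ball (0 : E) ε, ∀ t (ht : t ∈ K), Γ ξ t = γ ξ ⟨t, ht⟩ :=
    fun ξ hξ t ht => by
      rw [hγ ξ hξ]; rfl
  refine ⟨ε, hε, Γ, fun ξ hξ => ⟨intervalIntegral.integral_same, fun t ht => ⟨?_, ?_⟩⟩, ?_⟩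
  · rw [hΓ ξ hξ t (Ioo_subset_Icc_self ht)]
    exact ((γ ξ).norm_coe_le_norm _).trans_lt (hball ξ hξ).2.1
  · have htK : t ∈ K := Ioo_subset_Icc_self ht
    have h := hasDerivAt_primitiveIcc (W (ξ, γ ξ)) t
    rw [projIcc_of_mem _ htK] at h
    rw [hΓ ξ hξ t htK]
    exact h
  · have hs : ContDiffOn ℝ ∞ (fun ξ => γ ξ ⟨1, h1K⟩) (Metric.ball 0 ε) := fun ξ hξ => by
      obtain ⟨e, he⟩ := (hball ξ hξ).2.2
      have h := ψ.contDiffAt_symm (f₀' := e) (n := ∞) (hball ξ hξ).1 (by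
        rw [he]
        exact (hΦ.differentiable (by simp)).differentiableAt.hasFDerivAt) hΦ.contDiffAt
      have h2 : ContDiffAt ℝ ∞ (fun ξ : E => ψ.symm (ξ, (0 : C(K, E)))) ξ :=
        h.comp ξ (contDiffAt_id.prodMk contDiffAt_const)
      exact ((ContinuousMap.evalCLM ℝ (⟨1, h1K⟩ : K)).contDiff.contDiffAt.comp ξ
        h2.snd).contDiffWithinAt
    exact hs.congr fun ξ hξ => hΓ ξ hξ 1 h1K

end Picard

/-! ### One-parameter subgroups and the exponential map -/

section LieExp

open Set

variable {E : Type*} [NormedAddCommGroup E] [NormedSpace ℝ E]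
  {G : Type*} [TopologicalSpace G] [ChartedSpace E G] [Group G] [LieGroup 𝓘(ℝ, E) ∞ G]
  {E' : Type*} [NormedAddCommGroup E'] [NormedSpace ℝ E']
  {M' : Type*} [TopologicalSpace M'] [ChartedSpace E' M']

/-- The regularity under which the tangent space at `1` is known to be a Lie algebra. -/
instance lieGroup_minSmoothness : LieGroup 𝓘(ℝ, E) (minSmoothness ℝ 3) G := by
  rw [minSmoothness_of_isRCLikeNormedField]
  infer_instance

theorem mdifferentiable_leftMul (g : G) :
    MDifferentiable 𝓘(ℝ, E) 𝓘(ℝ, E) (fun h : G => g * h) :=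
  (contMDiff_mul_left (I := 𝓘(ℝ, E)) (n := ∞)).mdifferentiable (by simp)

/-- Derivatives along left-invariant vector fields are derivatives at `1` of left translates. -/
theorem mfderiv_mulInvariantVectorField {f : G → M'} {g : G}
    (hf : MDifferentiableAt 𝓘(ℝ, E) 𝓘(ℝ, E') f g) (ξ : GroupLieAlgebra 𝓘(ℝ, E) G) :
    (mfderiv 𝓘(ℝ, E) 𝓘(ℝ, E') f g (mulInvariantVectorField ξ g) : E') =
      mfderiv 𝓘(ℝ, E) 𝓘(ℝ, E') (fun h => f (g * h)) 1 ξ :=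
  (mfderiv_comp_apply_of_eq (x := (1 : G)) (f := fun h => g * h) hf
    (mdifferentiable_leftMul g 1) (mul_one g) ξ).symm

theorem mfderiv_mul_left_mulInvariantVectorField (g h : G) (ξ : GroupLieAlgebra 𝓘(ℝ, E) G) :
    (mfderiv 𝓘(ℝ, E) 𝓘(ℝ, E) (fun x : G => g * x) h (mulInvariantVectorField ξ h) : E) =
      mulInvariantVectorField ξ (g * h) := by
  refine (mfderiv_mulInvariantVectorField (mdifferentiable_leftMul g h) ξ).trans ?_
  exact congrArg (fun φ : G → G => (mfderiv 𝓘(ℝ, E) 𝓘(ℝ, E) φ 1 ξ : E))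
    (funext fun x => (mul_assoc g h x).symm)

theorem IsMIntegralCurveOn.mul_left {γ : ℝ → G} {ξ : GroupLieAlgebra 𝓘(ℝ, E) G} {s : Set ℝ}
    (h : IsMIntegralCurveOn (I := 𝓘(ℝ, E)) γ (mulInvariantVectorField ξ) s) (g : G) :
    IsMIntegralCurveOn (I := 𝓘(ℝ, E)) (fun t => g * γ t) (mulInvariantVectorField ξ) s := by
  intro t ht
  have h1 := ((mdifferentiable_leftMul g (γ t)).hasMFDerivAt).comp_hasMFDerivWithinAt t (h t ht)
  have h2 : ((mfderiv 𝓘(ℝ, E) 𝓘(ℝ, E) (fun x : G => g * x) (γ t)).comp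
      ((1 : ℝ →L[ℝ] ℝ).smulRight (mulInvariantVectorField ξ (γ t))) : ℝ →L[ℝ] E) =
      (1 : ℝ →L[ℝ] ℝ).smulRight (mulInvariantVectorField ξ (g * γ t)) := by
    refine ContinuousLinearMap.ext fun c => ?_
    have h3 := congrArg (fun v : E => c • v) (mfderiv_mul_left_mulInvariantVectorField g (γ t) ξ)
    exact ((mfderiv 𝓘(ℝ, E) 𝓘(ℝ, E) (fun x : G => g * x) (γ t)).map_smul c _).trans h3
  exact h2 ▸ h1

theorem contMDiff_one_mulInvariantVectorField (ξ : GroupLieAlgebra 𝓘(ℝ, E) G) :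
    ContMDiff 𝓘(ℝ, E) 𝓘(ℝ, E).tangent 1
      (fun g : G => (⟨g, mulInvariantVectorField ξ g⟩ : TangentBundle 𝓘(ℝ, E) G)) :=
  (contMDiff_mulInvariantVectorField ξ).of_le (by
    rw [minSmoothness_of_isRCLikeNormedField]; norm_num)

/-- Left-invariant vector fields are complete: an integral curve through `1` on a short interval
is moved to every point of the group by left multiplication. -/
theorem exists_isMIntegralCurve_mulInvariantVectorField [CompleteSpace E] [T2Space G]
    (ξ : GroupLieAlgebra 𝓘(ℝ, E) G) :
    ∃ γ : ℝ → G, γ 0 = 1 ∧ IsMIntegralCurve (I := 𝓘(ℝ, E)) γ (mulInvariantVectorField ξ) := by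
  have hv := contMDiff_one_mulInvariantVectorField (G := G) ξ
  obtain ⟨γ, h0, hγ⟩ := exists_isMIntegralCurveAt_of_contMDiffAt_boundaryless (t₀ := 0)
    (hv.contMDiffAt (x := 1))
  obtain ⟨ε, hε, hγε⟩ := isMIntegralCurveAt_iff'.1 hγ
  rw [Real.ball_eq_Ioo, zero_sub, zero_add] at hγε
  exact exists_isMIntegralCurve_of_isMIntegralCurveOn hv hε
    (fun g => ⟨fun t => g * γ t, by simp [h0], hγε.mul_left g⟩) 1

/-- By uniqueness of integral curves, the exponential map can be read off from any integral curve
on a neighbourhood of `[-1, 1]`. -/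
theorem lieExp_eq_of_isMIntegralCurveOn [CompleteSpace E] [T2Space G]
    {ξ : GroupLieAlgebra 𝓘(ℝ, E) G} {γ : ℝ → G} (h0 : γ 0 = 1)
    (hγ : IsMIntegralCurveOn (I := 𝓘(ℝ, E)) γ (mulInvariantVectorField ξ) (Ioo (-2) 2)) :
    lieExp ξ = γ 1 := by
  obtain ⟨γ₁, h1, hγ₁⟩ := exists_isMIntegralCurve_mulInvariantVectorField ξ
  have hex : ∃ g : G, ∃ γ : ℝ → G,
      γ 0 = 1 ∧ IsMIntegralCurve (I := 𝓘(ℝ, E)) γ (mulInvariantVectorField ξ) ∧ γ 1 = g :=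
    ⟨_, γ₁, h1, hγ₁, rfl⟩
  obtain ⟨γ₂, h2, hγ₂, h21⟩ := Classical.epsilon_spec hex
  have h := isMIntegralCurveOn_Ioo_eqOn_of_contMDiff_boundaryless (t₀ := 0)
    (⟨by norm_num, by norm_num⟩ : (0 : ℝ) ∈ Ioo (-2 : ℝ) 2)
    (contMDiff_one_mulInvariantVectorField ξ) (hγ₂.isMIntegralCurveOn _) hγ (h2.trans h0.symm)
  exact h21.symm.trans (h (⟨by norm_num, by norm_num⟩ : (1 : ℝ) ∈ Ioo (-2 : ℝ) 2))

theorem IsMIntegralCurve.hasDerivAt_comp {γ : ℝ → G} {ξ : GroupLieAlgebra 𝓘(ℝ, E) G}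
    (h : IsMIntegralCurve (I := 𝓘(ℝ, E)) γ (mulInvariantVectorField ξ)) {f : G → E'}
    (hf : MDifferentiable 𝓘(ℝ, E) 𝓘(ℝ, E') f) (t : ℝ) :
    HasDerivAt (fun t => f (γ t))
      (mfderiv 𝓘(ℝ, E) 𝓘(ℝ, E') (fun h => f (γ t * h)) 1 ξ : E') t := by
  let A : E →L[ℝ] E' := mfderiv 𝓘(ℝ, E) 𝓘(ℝ, E') f (γ t)
  let v : E := mulInvariantVectorField ξ (γ t)
  have h1 := ((hf (γ t)).hasMFDerivAt).comp t (h t)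
  have h2 : HasFDerivAt (fun t => f (γ t)) (A.comp ((1 : ℝ →L[ℝ] ℝ).smulRight v)) t :=
    hasMFDerivAt_iff_hasFDerivAt.1 h1
  have h3 : A.comp ((1 : ℝ →L[ℝ] ℝ).smulRight v) 1 = A v := by simp
  have h4 : A v = (mfderiv 𝓘(ℝ, E) 𝓘(ℝ, E') (fun h => f (γ t * h)) 1 ξ : E') :=
    mfderiv_mulInvariantVectorField (hf (γ t)) ξ
  exact (h3.trans h4) ▸ h2.hasDerivAt

end LieExp

/-! ### The derivative of a smooth linear action -/

section Operators

variable {G : Type*} [Group G] {V : Type*} [NormedAddCommGroup V] [NormedSpace ℝ V]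
  [FiniteDimensional ℝ V]

/-- The operators of a finite-dimensional representation, as continuous linear maps. -/
def repCLM (ρ : Representation ℝ G V) (g : G) : V →L[ℝ] V := (ρ g).toContinuousLinearMap

theorem repCLM_apply (ρ : Representation ℝ G V) (g : G) (x : V) : repCLM ρ g x = ρ g x := rfl

theorem repCLM_mul (ρ : Representation ℝ G V) (g h : G) :
    repCLM ρ (g * h) = repCLM ρ g * repCLM ρ h := by
  ext x; simp [repCLM]

theorem repCLM_one (ρ : Representation ℝ G V) : repCLM ρ 1 = 1 := by
  ext x; simp [repCLM]

end Operators

theorem eq_exp_of_hasDerivAt_mul {R : Type*} [NormedRing R] [NormedAlgebra ℝ R] [CompleteSpace R]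
    {y : ℝ → R} {a : R} (h0 : y 0 = 1) (hy : ∀ t, HasDerivAt y (y t * a) t) :
    y 1 = NormedSpace.exp a := by
  let _ : NormedAlgebra ℚ R := NormedAlgebra.restrictScalars ℚ ℝ R
  -- `y t * exp (-t a)` is constant
  have hz : ∀ t, HasDerivAt (fun t => y t * NormedSpace.exp (t • (-a))) 0 t := fun t => by
    have h := (hy t).mul (hasDerivAt_exp_smul_const' (𝕂 := ℝ) (-a) t)
    rwa [neg_mul, mul_neg, ← mul_assoc, add_neg_cancel] at h
  have hc := is_const_of_deriv_eq_zero (fun t => (hz t).differentiableAt)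
    (fun t => (hz t).deriv) 1 0
  simp only [one_smul, zero_smul, NormedSpace.exp_zero, mul_one, h0] at hc
  have hexp : NormedSpace.exp (-a) * NormedSpace.exp a = 1 := by
    rw [← NormedSpace.exp_add_of_commute ((Commute.refl a).neg_left), neg_add_cancel,
      NormedSpace.exp_zero]
  calc y 1 = y 1 * (NormedSpace.exp (-a) * NormedSpace.exp a) := by rw [hexp, mul_one]
    _ = NormedSpace.exp a := by rw [← mul_assoc, hc, one_mul]

section RepDeriv

variable {E : Type*} [NormedAddCommGroup E] [NormedSpace ℝ E]
  {G : Type*} [TopologicalSpace G] [ChartedSpace E G] [Group G]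
  {V : Type*} [NormedAddCommGroup V] [NormedSpace ℝ V] [FiniteDimensional ℝ V]

/-- The derivative at `1` of a linear action `ρ`: the associated representation of the Lie algebra,
with the latter regarded as the model space `E`. -/
def repDeriv (E : Type*) [NormedAddCommGroup E] [NormedSpace ℝ E] [ChartedSpace E G]
    (ρ : Representation ℝ G V) : E →L[ℝ] V →L[ℝ] V :=
  mfderiv 𝓘(ℝ, E) 𝓘(ℝ, V →L[ℝ] V) (repCLM ρ) 1

theorem contMDiff_repCLM {ρ : Representation ℝ G V}
    (hρ : ContMDiff (𝓘(ℝ, E).prod 𝓘(ℝ, V)) 𝓘(ℝ, V) ∞ (fun q : G × V => ρ q.1 q.2)) :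
    ContMDiff 𝓘(ℝ, E) 𝓘(ℝ, V →L[ℝ] V) ∞ (repCLM ρ) := by
  let b := Module.finBasis ℝ V
  let P : Fin (Module.finrank ℝ V) → V →L[ℝ] V →L[ℝ] V := fun i =>
    ContinuousLinearMap.smulRightL ℝ V V (LinearMap.toContinuousLinearMap (b.coord i))
  have hR : repCLM ρ = fun g => ∑ i, P i (ρ g (b i)) := by
    funext g
    refine ContinuousLinearMap.ext fun x => ?_
    conv_lhs => rw [repCLM_apply, ← b.sum_repr x, map_sum]
    simp [P]
  rw [hR]
  refine contMDiff_finsetSum fun i _ => ?_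
  exact (P i).contDiff.contMDiff.comp (hρ.comp (contMDiff_id.prodMk contMDiff_const))

variable {ρ : Representation ℝ G V}

theorem mfderiv_repCLM_mul_left (hR : MDifferentiable 𝓘(ℝ, E) 𝓘(ℝ, V →L[ℝ] V) (repCLM ρ))
    (g : G) (ξ : E) :
    (mfderiv 𝓘(ℝ, E) 𝓘(ℝ, V →L[ℝ] V) (fun h => repCLM ρ (g * h)) 1 ξ : V →L[ℝ] V) =
      repCLM ρ g * repDeriv E ρ ξ := by
  have h1 : HasMFDerivAt 𝓘(ℝ, V →L[ℝ] V) 𝓘(ℝ, V →L[ℝ] V) (fun T : V →L[ℝ] V => repCLM ρ g * T)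
      (repCLM ρ 1) (ContinuousLinearMap.mul ℝ (V →L[ℝ] V) (repCLM ρ g)) :=
    hasMFDerivAt_iff_hasFDerivAt.2 (ContinuousLinearMap.mul ℝ (V →L[ℝ] V) (repCLM ρ g)).hasFDerivAt
  have h2 := (h1.comp (1 : G) (hR 1).hasMFDerivAt).mfderiv
  have h3 : (fun h => repCLM ρ (g * h)) = (fun T : V →L[ℝ] V => repCLM ρ g * T) ∘ repCLM ρ :=
    funext fun h => repCLM_mul ρ g h
  rw [h3]
  exact DFunLike.congr_fun h2 ξ

variable [LieGroup 𝓘(ℝ, E) ∞ G]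

/-- A representation intertwines the exponential maps. -/
theorem repCLM_lieExp [CompleteSpace E] [T2Space G]
    (hR : MDifferentiable 𝓘(ℝ, E) 𝓘(ℝ, V →L[ℝ] V) (repCLM ρ)) (ξ : GroupLieAlgebra 𝓘(ℝ, E) G) :
    repCLM ρ (lieExp ξ) = NormedSpace.exp (repDeriv E ρ ξ) := by
  obtain ⟨γ, h0, hγ⟩ := exists_isMIntegralCurve_mulInvariantVectorField ξ
  rw [lieExp_eq_of_isMIntegralCurveOn h0 (hγ.isMIntegralCurveOn _)]
  refine eq_exp_of_hasDerivAt_mul (y := fun t => repCLM ρ (γ t)) (by rw [h0, repCLM_one])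
    fun t => ?_
  exact mfderiv_repCLM_mul_left hR (γ t) ξ ▸ hγ.hasDerivAt_comp hR t

/-- The derivative of the action along the right translate `ξ g` is the infinitesimal action of `ξ`
at the point `g · m`. -/
theorem actionDeriv_rightTranslate (hR : MDifferentiable 𝓘(ℝ, E) 𝓘(ℝ, V →L[ℝ] V) (repCLM ρ))
    (g : G) (m : V) (ξ : GroupLieAlgebra 𝓘(ℝ, E) G) :
    actionDeriv (E := E) ρ g m (rightTranslate ξ g) = repDeriv E ρ ξ (ρ g m) := by
  have hev : ∀ (x : V) (T : V →L[ℝ] V), HasMFDerivAt 𝓘(ℝ, V →L[ℝ] V) 𝓘(ℝ, V)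
      (fun T : V →L[ℝ] V => T x) T (ContinuousLinearMap.apply ℝ V x) := fun x T =>
    hasMFDerivAt_iff_hasFDerivAt.2 (ContinuousLinearMap.apply ℝ V x).hasFDerivAt
  have h1 : MDifferentiableAt 𝓘(ℝ, E) 𝓘(ℝ, V) (fun h : G => ρ h m) g :=
    ((hev m _).comp g (hR g).hasMFDerivAt).mdifferentiableAt
  have h2 : MDifferentiableAt 𝓘(ℝ, E) 𝓘(ℝ, E) (fun h : G => h * g) 1 :=
    (contMDiff_mul_right (I := 𝓘(ℝ, E)) (n := ∞)).mdifferentiable (by simp) 1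
  have h3 := mfderiv_comp_apply_of_eq (x := (1 : G)) (f := fun h : G => h * g) h1 h2 (one_mul g) ξ
  have h4 : ((fun h : G => ρ h m) ∘ fun h => h * g) =
      (fun T : V →L[ℝ] V => T (ρ g m)) ∘ repCLM ρ := by
    funext h
    simp [repCLM]
  have h5 := ((hev (ρ g m) _).comp (1 : G) (hR 1).hasMFDerivAt).mfderiv
  rw [h4] at h3
  exact h3.symm.trans (DFunLike.congr_fun h5 ξ)

end RepDeriv

/-! ### The group in a chart at the identity -/

section ChartAtOne

open Set

variable (E : Type*) [NormedAddCommGroup E] [NormedSpace ℝ E]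
  (G : Type*) [TopologicalSpace G] [ChartedSpace E G] [Group G]

/-- The coordinates of the identity in the preferred chart at the identity. -/
def chartOrigin : E := extChartAt 𝓘(ℝ, E) (1 : G) 1

/-- The inverse of the preferred chart at the identity. -/
def chartInv (x : E) : G := (extChartAt 𝓘(ℝ, E) (1 : G)).symm x

/-- The group multiplication in the preferred chart at the identity. -/
def chartMul (q : E × E) : E := extChartAt 𝓘(ℝ, E) (1 : G) (chartInv E G q.1 * chartInv E G q.2)

/-- The frame of left-invariant vector fields in the preferred chart at the identity: the derivative
of the multiplication `chartMul` in its second slot. -/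
def chartFrame (x : E) : E →L[ℝ] E :=
  (fderiv ℝ (chartMul E G) (x, chartOrigin E G)).comp (ContinuousLinearMap.inr ℝ E E)

/-- The derivative of the inverse of the preferred chart, with values in the model space. -/
def chartInvDeriv (x : E) : E →L[ℝ] E := mfderiv 𝓘(ℝ, E) 𝓘(ℝ, E) (chartInv E G) x

/-- The derivative at the identity of the preferred chart, with values in the model space. -/
def chartDeriv : E →L[ℝ] E :=
  mfderiv 𝓘(ℝ, E) 𝓘(ℝ, E) (extChartAt 𝓘(ℝ, E) (1 : G)) (1 : G)

theorem chartInv_chartOrigin : chartInv E G (chartOrigin E G) = 1 := extChartAt_to_inv 1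

/-- `δ` is the radius of a ball about the origin of the preferred chart at the identity in which any
two points can be multiplied without leaving the domain of the chart. -/
structure IsChartRadius (δ : ℝ) : Prop where
  pos : 0 < δ
  ball_subset : Metric.ball (chartOrigin E G) δ ⊆ (extChartAt 𝓘(ℝ, E) (1 : G)).target
  mul_mem_source : ∀ x ∈ Metric.ball (chartOrigin E G) δ, ∀ y ∈ Metric.ball (chartOrigin E G) δ,
    chartInv E G x * chartInv E G y ∈ (extChartAt 𝓘(ℝ, E) (1 : G)).source
  contDiffOn_chartMul : ContDiffOn ℝ ∞ (chartMul E G)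
    (Metric.ball (chartOrigin E G) δ ×ˢ Metric.ball (chartOrigin E G) δ)

theorem IsChartRadius.contDiffOn_chartFrame {E : Type*} [NormedAddCommGroup E] [NormedSpace ℝ E]
    {G : Type*} [TopologicalSpace G] [ChartedSpace E G] [Group G] {δ : ℝ}
    (hδ : IsChartRadius E G δ) :
    ContDiffOn ℝ ∞ (chartFrame E G) (Metric.ball (chartOrigin E G) δ) := by
  have h1 := hδ.contDiffOn_chartMul.fderiv_of_isOpen (m := ∞)
    (Metric.isOpen_ball.prod Metric.isOpen_ball) (by simp)
  have h2 : ContDiffOn ℝ ∞ (fun x => fderiv ℝ (chartMul E G) (x, chartOrigin E G))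
      (Metric.ball (chartOrigin E G) δ) :=
    h1.comp (contDiff_id.prodMk contDiff_const).contDiffOn
      fun x hx => ⟨hx, Metric.mem_ball_self hδ.pos⟩
  exact h2.clm_comp contDiffOn_const

variable [LieGroup 𝓘(ℝ, E) ∞ G]

theorem contMDiffOn_chartInv :
    ContMDiffOn 𝓘(ℝ, E) 𝓘(ℝ, E) ∞ (chartInv E G) (extChartAt 𝓘(ℝ, E) (1 : G)).target :=
  contMDiffOn_extChartAt_symm 1

theorem hasMFDerivAt_chartInv {x : E} (hx : x ∈ (extChartAt 𝓘(ℝ, E) (1 : G)).target) :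
    HasMFDerivAt 𝓘(ℝ, E) 𝓘(ℝ, E) (chartInv E G) x (chartInvDeriv E G x) :=
  (((contMDiffOn_chartInv E G).contMDiffAt ((isOpen_extChartAt_target 1).mem_nhds hx)
    ).mdifferentiableAt (by simp)).hasMFDerivAt

theorem exists_isChartRadius : ∃ δ, IsChartRadius E G δ := by
  set e := chartOrigin E G
  set t := (extChartAt 𝓘(ℝ, E) (1 : G)).target
  set s := (extChartAt 𝓘(ℝ, E) (1 : G)).source
  have het : e ∈ t := mem_extChartAt_target 1
  have hto : IsOpen t := isOpen_extChartAt_target 1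
  have hm : ContMDiffOn 𝓘(ℝ, E × E) 𝓘(ℝ, E) ∞
      (fun q : E × E => chartInv E G q.1 * chartInv E G q.2) (t ×ˢ t) :=
    ((contMDiffOn_chartInv E G).comp contDiff_fst.contMDiff.contMDiffOn fun q hq => hq.1).mul
      ((contMDiffOn_chartInv E G).comp contDiff_snd.contMDiff.contMDiffOn fun q hq => hq.2)
  have hopen : IsOpen ((t ×ˢ t) ∩
      (fun q : E × E => chartInv E G q.1 * chartInv E G q.2) ⁻¹' s) :=
    hm.continuousOn.isOpen_inter_preimage (hto.prod hto) (isOpen_extChartAt_source 1)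
  have hmem : (e, e) ∈ (t ×ˢ t) ∩
      (fun q : E × E => chartInv E G q.1 * chartInv E G q.2) ⁻¹' s := by
    refine ⟨⟨het, het⟩, ?_⟩
    show chartInv E G e * chartInv E G e ∈ s
    rw [chartInv_chartOrigin, mul_one]
    exact mem_extChartAt_source 1
  obtain ⟨δ, hδ, hsub⟩ := Metric.isOpen_iff.1 hopen _ hmem
  rw [← ball_prod_same] at hsub
  refine ⟨δ, hδ, fun x hx => (hsub (mk_mem_prod hx (Metric.mem_ball_self hδ))).1.1,
    fun x hx y hy => (hsub (mk_mem_prod hx hy)).2, ?_⟩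
  have hθ : ContMDiffOn 𝓘(ℝ, E) 𝓘(ℝ, E) ∞ (extChartAt 𝓘(ℝ, E) (1 : G)) s := by
    rw [show s = (chartAt E (1 : G)).source from extChartAt_source _ _]
    exact contMDiffOn_extChartAt
  exact contMDiffOn_iff_contDiffOn.1
    (hθ.comp (hm.mono fun q hq => (hsub hq).1) fun q hq => (hsub hq).2)

variable {E G} {δ : ℝ}

/-- In the chart, `chartFrame · a` represents a left-invariant vector field. -/
theorem mulInvariantVectorField_chartInv (hδ : IsChartRadius E G δ)
    {x : E} (hx : x ∈ Metric.ball (chartOrigin E G) δ) (a : E) :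
    (mulInvariantVectorField (I := 𝓘(ℝ, E)) (G := G)
      (chartInvDeriv E G (chartOrigin E G) a) (chartInv E G x) : E) =
      chartInvDeriv E G x (chartFrame E G x a) := by
  set e := chartOrigin E G
  have he : e ∈ Metric.ball e δ := Metric.mem_ball_self hδ.pos
  have hμx : chartMul E G (x, e) = x := by
    simp only [chartMul, e, chartInv_chartOrigin, mul_one]
    exact (extChartAt 𝓘(ℝ, E) (1 : G)).right_inv (hδ.ball_subset hx)
  -- differentiate `chartInv x * chartInv y = chartInv (chartMul (x, y))` in `y` at the origin
  have hf : HasFDerivAt (fun y => chartMul E G (x, y)) (chartFrame E G x) e := by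
    have h1 : HasFDerivAt (chartMul E G) (fderiv ℝ (chartMul E G) (x, e)) (x, e) :=
      ((hδ.contDiffOn_chartMul.contDiffAt ((Metric.isOpen_ball.prod Metric.isOpen_ball).mem_nhds
        (mk_mem_prod hx he))).differentiableAt (by simp)).hasFDerivAt
    exact h1.comp e (hasFDerivAt_prodMk_right x e)
  have h1 : HasMFDerivAt 𝓘(ℝ, E) 𝓘(ℝ, E)
      (chartInv E G ∘ fun y => chartMul E G (x, y)) e
      ((chartInvDeriv E G x).comp (chartFrame E G x)) := by
    refine HasMFDerivAt.comp e ?_ (hasMFDerivAt_iff_hasFDerivAt.2 hf)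
    rw [hμx]
    exact hasMFDerivAt_chartInv E G (hδ.ball_subset hx)
  have h2 : HasMFDerivAt 𝓘(ℝ, E) 𝓘(ℝ, E)
      ((fun g : G => chartInv E G x * g) ∘ chartInv E G) e
      ((mfderiv 𝓘(ℝ, E) 𝓘(ℝ, E) (fun g : G => chartInv E G x * g) 1 : E →L[ℝ] E).comp
        (chartInvDeriv E G e)) := by
    refine HasMFDerivAt.comp e ?_ (hasMFDerivAt_chartInv E G (hδ.ball_subset he))
    rw [show chartInv E G e = 1 from chartInv_chartOrigin E G]
    exact (mdifferentiable_leftMul _ 1).hasMFDerivAt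
  have hev : ((fun g : G => chartInv E G x * g) ∘ chartInv E G) =ᶠ[𝓝 e]
      (chartInv E G ∘ fun y => chartMul E G (x, y)) := by
    filter_upwards [Metric.ball_mem_nhds e hδ.pos] with y hy
    exact ((extChartAt 𝓘(ℝ, E) (1 : G)).left_inv (hδ.mul_mem_source x hx y hy)).symm
  exact DFunLike.congr_fun (hasMFDerivAt_unique h2 (h1.congr_of_eventuallyEq hev)) a

theorem chartInvDeriv_chartDeriv (u : E) :
    chartInvDeriv E G (chartOrigin E G) (chartDeriv E G u) = u := by
  have hQ : HasMFDerivAt 𝓘(ℝ, E) 𝓘(ℝ, E) (extChartAt 𝓘(ℝ, E) (1 : G)) (1 : G)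
      (chartDeriv E G) :=
    ((contMDiffAt_extChartAt (n := ∞)).mdifferentiableAt (by simp)).hasMFDerivAt
  have h1 := (hasMFDerivAt_chartInv E G (mem_extChartAt_target (I := 𝓘(ℝ, E)) (1 : G))).comp
    (1 : G) hQ
  have h2 : HasMFDerivAt 𝓘(ℝ, E) 𝓘(ℝ, E) (id : G → G) 1
    (ContinuousLinearMap.id ℝ E) := hasMFDerivAt_id 1
  have hev : (id : G → G) =ᶠ[𝓝 1] chartInv E G ∘ extChartAt 𝓘(ℝ, E) (1 : G) := by
    filter_upwards [extChartAt_source_mem_nhds (I := 𝓘(ℝ, E)) (1 : G)] with g hg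
    exact ((extChartAt 𝓘(ℝ, E) (1 : G)).left_inv hg).symm
  exact DFunLike.congr_fun (hasMFDerivAt_unique (h1.congr_of_eventuallyEq hev) h2) u

/-- The exponential map is smooth near the origin. -/
theorem exists_contMDiffOn_lieExp [FiniteDimensional ℝ E] [T2Space G] : ∃ ε > 0,
    ContMDiffOn 𝓘(ℝ, E) 𝓘(ℝ, E) ∞
      (fun ξ : E => lieExp (E := E) (G := G) ξ) (Metric.ball 0 ε) := by
  have : CompleteSpace E := FiniteDimensional.complete ℝ E
  obtain ⟨δ, hδ⟩ := exists_isChartRadius E G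
  set e := chartOrigin E G with he
  have hball : ∀ x : E, ‖x‖ < δ → e + x ∈ Metric.ball e δ := fun x hx => by simpa using hx
  -- a global smooth extension of the frame, centred at the origin of `E`
  obtain ⟨g, hg, hgF⟩ := exists_contDiff_eq_of_contDiffOn_ball (V := E)
    (f := fun q => chartFrame E G (e + q.1)) hδ.pos
    (hδ.contDiffOn_chartFrame.comp (contDiff_const.add contDiff_fst).contDiffOn fun q hq =>
      hball q.1 (by simpa using hq.1))
  have hL : ContDiff ℝ ∞ fun x => g (x, 0) := hg.comp (contDiff_id.prodMk contDiff_const)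
  obtain ⟨ε, hε, Γ, hΓ, hΓs⟩ := exists_solution_contDiffOn hL (half_pos hδ.pos)
  have hQ : ∀ᶠ ξ in 𝓝 (0 : E), chartDeriv E G ξ ∈ Metric.ball (0 : E) ε :=
    (chartDeriv E G).continuous.continuousAt.eventually_mem
      (by rw [map_zero]; exact Metric.ball_mem_nhds 0 hε)
  obtain ⟨ε', hε', hQε⟩ := Metric.eventually_nhds_iff_ball.1 hQ
  have h1 : (1 : ℝ) ∈ Ioo (-2 : ℝ) 2 := ⟨by norm_num, by norm_num⟩
  have hexp : ∀ ξ ∈ Metric.ball (0 : E) ε',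
      lieExp (E := E) (G := G) ξ = chartInv E G (e + Γ (chartDeriv E G ξ) 1) := fun ξ hξ => by
    set a := chartDeriv E G ξ
    obtain ⟨h0, ha⟩ := hΓ a (hQε ξ hξ)
    refine lieExp_eq_of_isMIntegralCurveOn (γ := fun t => chartInv E G (e + Γ a t)) ?_
      fun t ht => ?_
    · simp only [h0, add_zero]
      exact chartInv_chartOrigin E G
    · obtain ⟨hsmall, hder⟩ := ha t ht
      have hx : e + Γ a t ∈ Metric.ball e δ := hball _ (hsmall.trans (half_lt_self hδ.pos))
      rw [hgF (Γ a t) (by simpa using hsmall.le) 0] at hder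
      have h2 := (hasMFDerivAt_chartInv E G (hδ.ball_subset hx)).comp t
        (hasMFDerivAt_iff_hasFDerivAt.2 (hder.const_add e).hasFDerivAt)
      have h3 := mulInvariantVectorField_chartInv hδ hx a
      rw [chartInvDeriv_chartDeriv] at h3
      have h4 : ∀ (A : E →L[ℝ] E) (v : E), A.comp (ContinuousLinearMap.toSpanSingleton ℝ v) =
          (1 : ℝ →L[ℝ] ℝ).smulRight (A v) := fun A v => by ext; simp
      have h5 := (h4 (chartInvDeriv E G (e + Γ a t)) (chartFrame E G (e + Γ a t) a)).trans
        (congrArg (fun v : E => (1 : ℝ →L[ℝ] ℝ).smulRight v) h3.symm)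
      exact (h5 ▸ h2).hasMFDerivWithinAt
  refine ⟨ε', hε', ContMDiffOn.congr ?_ hexp⟩
  refine (contMDiffOn_chartInv E G).comp ?_ fun ξ hξ => hδ.ball_subset (hball _
    (((hΓ _ (hQε ξ hξ)).2 1 h1).1.trans (half_lt_self hδ.pos)))
  exact (contDiffOn_const.add (hΓs.comp (chartDeriv E G).contDiff.contDiffOn
    fun ξ hξ => hQε ξ hξ)).contMDiffOn

end ChartAtOne

/-! ### The Lie bracket and the derivative of a linear action -/

section Bracket

open Set VectorField

variable {E : Type*} [NormedAddCommGroup E] [NormedSpace ℝ E]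

/-- The relation `f' W = f b`, differentiated along `V`. -/
theorem fderiv_apply_fderiv_of_eventually_eq {R : Type*} [NormedRing R] [NormedAlgebra ℝ R]
    {f : E → R} {V W : E → E} {b : R} {x : E} (hf : ContDiffAt ℝ 2 f x)
    (hW : DifferentiableAt ℝ W x) (hWb : ∀ᶠ y in 𝓝 x, fderiv ℝ f y (W y) = f y * b) :
    fderiv ℝ f x (fderiv ℝ W x (V x)) + fderiv ℝ (fderiv ℝ f) x (V x) (W x) =
      fderiv ℝ f x (V x) * b := by
  have h1 : DifferentiableAt ℝ (fderiv ℝ f) x :=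
    (hf.fderiv_right (m := 1) (by norm_num)).differentiableAt (by norm_num)
  have h2 := (h1.hasFDerivAt.clm_apply hW.hasFDerivAt).congr_of_eventuallyEq
    (f₁ := fun y => f y * b) (hWb.mono fun y hy => hy.symm)
  have h3 := (hf.differentiableAt (by norm_num)).hasFDerivAt.mul_const' b
  have h4 := DFunLike.congr_fun (h2.unique h3) (V x)
  simpa using h4

/-- If `f` intertwines two vector fields with right multiplications by `a` and `b`, it intertwines
their Lie bracket with the commutator of `a` and `b`. -/
theorem fderiv_lieBracket_of_eventually_eq {R : Type*} [NormedRing R] [NormedAlgebra ℝ R]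
    {f : E → R} {V W : E → E} {a b : R} {x : E} (hf : ContDiffAt ℝ 2 f x) (hfx : f x = 1)
    (hV : DifferentiableAt ℝ V x) (hW : DifferentiableAt ℝ W x)
    (hVa : ∀ᶠ y in 𝓝 x, fderiv ℝ f y (V y) = f y * a)
    (hWb : ∀ᶠ y in 𝓝 x, fderiv ℝ f y (W y) = f y * b) :
    fderiv ℝ f x (lieBracket ℝ V W x) = a * b - b * a := by
  have h1 := fderiv_apply_fderiv_of_eventually_eq (V := V) hf hW hWb
  have h2 := fderiv_apply_fderiv_of_eventually_eq (V := W) hf hV hVa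
  have hs : fderiv ℝ (fderiv ℝ f) x (V x) (W x) = fderiv ℝ (fderiv ℝ f) x (W x) (V x) :=
    hf.isSymmSndFDerivAt (by simp) (V x) (W x)
  rw [hVa.self_of_nhds, hfx, one_mul] at h1
  rw [hWb.self_of_nhds, hfx, one_mul] at h2
  rw [lieBracket_eq, map_sub, ← h1, ← h2, hs]
  abel

variable {G : Type*} [TopologicalSpace G] [ChartedSpace E G] [Group G] [LieGroup 𝓘(ℝ, E) ∞ G]

theorem isInvertible_chartInvDeriv {x : E} (hx : x ∈ (extChartAt 𝓘(ℝ, E) (1 : G)).target) :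
    (chartInvDeriv E G x).IsInvertible := by
  have h := isInvertible_mfderivWithin_extChartAt_symm hx
  have hr : range (𝓘(ℝ, E) : ModelWithCorners ℝ E E) = univ := by simp
  rw [hr, mfderivWithin_univ] at h
  exact h

variable (E G) in
/-- The bracket of the Lie algebra, with the latter regarded as the model space `E`. -/
def modelBracket (u v : E) : E :=
  Bracket.bracket (L := GroupLieAlgebra 𝓘(ℝ, E) G) (M := GroupLieAlgebra 𝓘(ℝ, E) G) u v

/-- The coordinates of the Lie bracket of the Lie algebra. -/
theorem chartDeriv_modelBracket (u v : E) :
    chartDeriv E G (modelBracket E G u v) =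
      lieBracket ℝ (fun x => chartFrame E G x (chartDeriv E G u))
        (fun x => chartFrame E G x (chartDeriv E G v)) (chartOrigin E G) := by
  obtain ⟨δ, hδ⟩ := exists_isChartRadius E G
  -- the representation in the chart of a left-invariant vector field
  let P : E → E → E := fun w =>
    mpullbackWithin 𝓘(ℝ, E) 𝓘(ℝ, E) (extChartAt 𝓘(ℝ, E) (1 : G)).symm
      (mulInvariantVectorField (I := 𝓘(ℝ, E)) (G := G) w) (range (𝓘(ℝ, E) : ModelWithCorners ℝ E E))
  have hP : ∀ w, P w =ᶠ[𝓝 (chartOrigin E G)] fun x => chartFrame E G x (chartDeriv E G w) := by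
    intro w
    filter_upwards [Metric.ball_mem_nhds _ hδ.pos] with x hx
    have h1 : P w x = (chartInvDeriv E G x).inverse
        (mulInvariantVectorField (I := 𝓘(ℝ, E)) (G := G) w (chartInv E G x) : E) := by
      have hr : range (𝓘(ℝ, E) : ModelWithCorners ℝ E E) = univ := by simp
      simp only [P, hr, mpullbackWithin_univ]
      rfl
    have h2 := mulInvariantVectorField_chartInv hδ hx (chartDeriv E G w)
    rw [chartInvDeriv_chartDeriv] at h2
    rw [h1, h2]
    exact (isInvertible_chartInvDeriv (hδ.ball_subset hx)).inverse_apply_self _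
  have h1 : modelBracket E G u v = (chartDeriv E G).inverse
      (lieBracketWithin ℝ (P u) (P v)
        ((extChartAt 𝓘(ℝ, E) (1 : G)).symm ⁻¹' univ ∩
          range (𝓘(ℝ, E) : ModelWithCorners ℝ E E)) (chartOrigin E G)) := rfl
  have hset : ((extChartAt 𝓘(ℝ, E) (1 : G)).symm ⁻¹' univ ∩
          range (𝓘(ℝ, E) : ModelWithCorners ℝ E E)) = univ := by simp
  rw [hset, lieBracketWithin_univ, (hP u).lieBracket_vectorField_eq (hP v)] at h1
  have hinv : (chartDeriv E G).IsInvertible :=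
    isInvertible_mfderiv_extChartAt (mem_extChartAt_source (I := 𝓘(ℝ, E)) (1 : G))
  rw [h1]
  exact hinv.self_apply_inverse _

variable {V : Type*} [NormedAddCommGroup V] [NormedSpace ℝ V] [FiniteDimensional ℝ V]
  {ρ : Representation ℝ G V}

/-- The derivative of a representation of a Lie group is a representation of its Lie algebra. -/
theorem repDeriv_modelBracket (hR : ContMDiff 𝓘(ℝ, E) 𝓘(ℝ, V →L[ℝ] V) ∞ (repCLM ρ)) (u v : E) :
    repDeriv E ρ (modelBracket E G u v) =
      repDeriv E ρ u * repDeriv E ρ v - repDeriv E ρ v * repDeriv E ρ u := by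
  obtain ⟨δ, hδ⟩ := exists_isChartRadius E G
  set e := chartOrigin E G
  have hRd : MDifferentiable 𝓘(ℝ, E) 𝓘(ℝ, V →L[ℝ] V) (repCLM ρ) := hR.mdifferentiable (by simp)
  let f : E → V →L[ℝ] V := fun x => repCLM ρ (chartInv E G x)
  have hf : ContDiffOn ℝ ∞ f (Metric.ball e δ) :=
    contMDiffOn_iff_contDiffOn.1
      (hR.comp_contMDiffOn ((contMDiffOn_chartInv E G).mono hδ.ball_subset))
  have he : e ∈ Metric.ball e δ := Metric.mem_ball_self hδ.pos
  have hfe : f e = 1 := by simp only [f, e, chartInv_chartOrigin, repCLM_one]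
  let D : G → E →L[ℝ] V →L[ℝ] V := fun g => mfderiv 𝓘(ℝ, E) 𝓘(ℝ, V →L[ℝ] V) (repCLM ρ) g
  have hfd : ∀ x ∈ Metric.ball e δ, ∀ a,
      fderiv ℝ f x a = D (chartInv E G x) (chartInvDeriv E G x a) := fun x hx a => by
    have h1 := (hRd (chartInv E G x)).hasMFDerivAt.comp x
      (hasMFDerivAt_chartInv E G (hδ.ball_subset hx))
    have h2 : HasFDerivAt f ((D (chartInv E G x)).comp (chartInvDeriv E G x)) x :=
      hasMFDerivAt_iff_hasFDerivAt.1 h1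
    rw [h2.fderiv]
    rfl
  have hfr : ∀ w : E, fderiv ℝ f e (chartDeriv E G w) = repDeriv E ρ w := fun w => by
    rw [hfd e he, chartInvDeriv_chartDeriv, chartInv_chartOrigin E G]
    rfl
  have hframe : ∀ w : E, ∀ᶠ x in 𝓝 e,
      fderiv ℝ f x (chartFrame E G x (chartDeriv E G w)) = f x * repDeriv E ρ w := fun w => by
    filter_upwards [Metric.ball_mem_nhds _ hδ.pos] with x hx
    have h2 := mulInvariantVectorField_chartInv hδ hx (chartDeriv E G w)
    rw [chartInvDeriv_chartDeriv] at h2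
    rw [hfd x hx, ← h2]
    exact (mfderiv_mulInvariantVectorField (hRd (chartInv E G x)) w).trans
      (mfderiv_repCLM_mul_left hRd _ w)
  have hd : ∀ w : E, DifferentiableAt ℝ (fun x => chartFrame E G x (chartDeriv E G w)) e :=
    fun w => ((hδ.contDiffOn_chartFrame.contDiffAt
      (Metric.ball_mem_nhds _ hδ.pos)).differentiableAt (by simp)).clm_apply
      (differentiableAt_const _)
  rw [← hfr (modelBracket E G u v), chartDeriv_modelBracket]
  exact fderiv_lieBracket_of_eventually_eq
    (contDiffAt_infty.1 (hf.contDiffAt (Metric.ball_mem_nhds _ hδ.pos)) 2) hfe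
    (hd u) (hd v) (hframe u) (hframe v)

/-- The adjoint representation of the Lie algebra, with the latter regarded as the model space `E`. -/
def adCLM (E : Type*) [NormedAddCommGroup E] [NormedSpace ℝ E] [FiniteDimensional ℝ E]
    (G : Type*) [TopologicalSpace G] [ChartedSpace E G] [Group G] [LieGroup 𝓘(ℝ, E) ∞ G] :
    E →L[ℝ] E →L[ℝ] E :=
  have : CompleteSpace E := FiniteDimensional.complete ℝ E
  LinearMap.toContinuousLinearMap
    { toFun := fun u => LinearMap.toContinuousLinearMap
        { toFun := fun v => modelBracket E G u v
          map_add' := fun v w => lie_add (L := GroupLieAlgebra 𝓘(ℝ, E) G)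
            (M := GroupLieAlgebra 𝓘(ℝ, E) G) u v w
          map_smul' := fun c v => lie_smul (L := GroupLieAlgebra 𝓘(ℝ, E) G)
            (M := GroupLieAlgebra 𝓘(ℝ, E) G) c u v }
      map_add' := fun u v => by
        ext w
        exact add_lie (L := GroupLieAlgebra 𝓘(ℝ, E) G) (M := GroupLieAlgebra 𝓘(ℝ, E) G) u v w
      map_smul' := fun c u => by
        ext w
        exact smul_lie (L := GroupLieAlgebra 𝓘(ℝ, E) G) (M := GroupLieAlgebra 𝓘(ℝ, E) G) c u w }

theorem adCLM_self [FiniteDimensional ℝ E] (u : E) : adCLM E G u u = 0 :=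
  have : CompleteSpace E := FiniteDimensional.complete ℝ E
  lie_self (L := GroupLieAlgebra 𝓘(ℝ, E) G) u

end Bracket

/-! ### The combined step on the Lie algebra, and its effect on leaves -/

section Assembly

open Set

variable {E : Type*} [NormedAddCommGroup E] [NormedSpace ℝ E] [FiniteDimensional ℝ E]
  {G : Type*} [TopologicalSpace G] [ChartedSpace E G] [Group G] [LieGroup 𝓘(ℝ, E) ∞ G]
  {V : Type*} [NormedAddCommGroup V] [NormedSpace ℝ V] [FiniteDimensional ℝ V]
  {s : ℕ} {ρ : Representation ℝ G V}

theorem dexpInvTerm_eq (r : ℕ∞) (u v : E) (k : ℕ) :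
    (dexpInvTerm (E := E) (G := G) r u v k : E) =
      truncBernoulliCoeff r k • (adCLM E G u ^ k) v := by
  have hit : ((fun w : E => modelBracket E G u w)^[k] v : E) = (adCLM E G u ^ k) v := by
    rw [FunLike.coe_pow_eq_iterate]
    rfl
  unfold dexpInvTerm truncBernoulliCoeff
  split_ifs with h
  · rw [← hit]
    rfl
  · exact (zero_smul ℝ _).symm

theorem dexpInv_eq (r : ℕ∞) (u v : E) :
    (dexpInv (E := E) (G := G) r u v : E) =
      ∑' k, truncBernoulliCoeff r k • (adCLM E G u ^ k) v :=
  congrArg (fun f : ℕ → E => ∑' k, f k) (funext fun k => dexpInvTerm_eq (G := G) r u v k)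

/-- The combined step depends on the group only through the bracket of its Lie algebra, the derivative
`repDeriv` of the action, and the map `(u, m) ↦ A (exp u, m)`. -/
theorem combinedStep_eq_algebraStep [T2Space G]
    (hR : MDifferentiable 𝓘(ℝ, E) 𝓘(ℝ, V →L[ℝ] V) (repCLM ρ)) (T : ButcherTableau s) (r : ℕ∞)
    (A : G → V → GroupLieAlgebra 𝓘(ℝ, E) G) (Y : V → V) :
    CombinedStep ρ T r A Y = AlgebraStep T r (adCLM E G) (repDeriv E ρ)
      (fun q => A (lieExp (E := E) q.1) q.2) Y := by
  have : CompleteSpace E := FiniteDimensional.complete ℝ E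
  funext τ x x'
  let K : E → V → ℕ → E := fun u m k =>
    truncBernoulliCoeff r k • (adCLM E G u ^ k) (A (lieExp (E := E) u) m)
  have hK : (fun (u : E) (m : V) => (dexpInvTerm (G := G) r u (A (lieExp (E := E) u) m) : ℕ → E))
      = K := funext fun u => funext fun m => funext fun k => dexpInvTerm_eq r u _ k
  have hK' : (fun (u : E) (m : V) => (dexpInv (G := G) r u (A (lieExp (E := E) u) m) : E)) =
      fun u m => ∑' k, K u m k := funext fun u => funext fun m => dexpInv_eq r u _
  have hstage : ∀ (M : ℝ → Fin s → V) (U : ℝ → Fin s → E),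
      MKStageBranch (E := E) T r A τ M U ↔
      (ContinuousOn U (Set.uIcc 0 τ) ∧ ∀ t ∈ Set.uIcc 0 τ,
        (∀ j, Summable (K (U t j) (M t j))) ∧
        ∀ i, U t i = t • ∑ j, T.a i j • ∑' k, K (U t j) (M t j) k) := fun M U => by
    have h : ∀ F F' : E → V → ℕ → E, F = F' → ∀ f f' : E → V → E, f = f' →
        ((ContinuousOn U (Set.uIcc 0 τ) ∧ ∀ t ∈ Set.uIcc 0 τ,
          (∀ j, Summable (F (U t j) (M t j))) ∧
          ∀ i, U t i = t • ∑ j, T.a i j • f (U t j) (M t j)) ↔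
        (ContinuousOn U (Set.uIcc 0 τ) ∧ ∀ t ∈ Set.uIcc 0 τ,
          (∀ j, Summable (F' (U t j) (M t j))) ∧
          ∀ i, U t i = t • ∑ j, T.a i j • f' (U t j) (M t j))) := by
      rintro F _ rfl f _ rfl
      exact Iff.rfl
    exact h _ _ hK _ _ hK'
  have hupd : ∀ (M : Fin s → V) (U : Fin s → E) (m : V),
      ρ (mkUpdate (E := E) T r A τ M U) m =
        NormedSpace.exp (repDeriv E ρ (τ • ∑ i, T.b i • ∑' k, K (U i) (M i) k)) m := fun M U m =>
    (DFunLike.congr_fun (repCLM_lieExp hR _) m).trans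
      (congrArg (fun f : E → V → E =>
        NormedSpace.exp (repDeriv E ρ (τ • ∑ i, T.b i • f (U i) (M i))) m) hK')
  refine propext (exists_congr fun M => exists_congr fun U => ?_)
  exact and_congr Iff.rfl (and_congr (hstage M U)
    ⟨fun h => h.trans (hupd _ _ _), fun h => h.trans (hupd _ _ _).symm⟩)

end Assembly

section Leaves

/-- The operators of a finite-dimensional representation, as continuous linear equivalences. -/
def repEquiv {G V : Type*} [Group G] [NormedAddCommGroup V] [NormedSpace ℝ V]
    [FiniteDimensional ℝ V] (ρ : Representation ℝ G V) (g : G) : V ≃L[ℝ] V :=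
  LinearEquiv.toContinuousLinearEquiv
    { ρ g with
      invFun := ρ g⁻¹
      left_inv := ρ.inv_self_apply g
      right_inv := ρ.self_inv_apply g }

theorem step_rep {G V : Type*} [Group G] [NormedAddCommGroup V] [NormedSpace ℝ V]
    [FiniteDimensional ℝ V] {s : ℕ} {ρ : Representation ℝ G V} {T : ButcherTableau s} {Xinv : V → V}
    (hinv : ∀ (g : G) (x : V), Xinv (ρ g x) = ρ g (Xinv x)) {τ : ℝ} {x m : V}
    (h : T.Step Xinv τ x m) (g : G) : T.Step Xinv τ (ρ g x) (ρ g m) :=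
  ButcherTableau.Step.map (repEquiv ρ g) (hinv g) h

variable {E : Type*} [NormedAddCommGroup E] [NormedSpace ℝ E]
  {G : Type*} [TopologicalSpace G] [ChartedSpace E G] [Group G]
  {V : Type*} [NormedAddCommGroup V] [NormedSpace ℝ V]
  {s : ℕ} {ρ : Representation ℝ G V} {T : ButcherTableau s} {r : ℕ∞}
  {A : G → V → GroupLieAlgebra 𝓘(ℝ, E) G} {Xinv : V → V}

/-- The combined step moves a point within the leaf of the result of the Runge-Kutta step for the
invariant field. -/
theorem CombinedStep.exists_step {τ : ℝ} {x x' : V} (h : CombinedStep ρ T r A Xinv τ x x') :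
    ∃ g m, T.Step Xinv τ x m ∧ x' = ρ g m := by
  obtain ⟨M, U, hM, -, rfl⟩ := h
  exact ⟨_, _, ⟨M, hM, rfl⟩, rfl⟩

variable [FiniteDimensional ℝ V]

/-- The combined step maps leaves to leaves: the Runge-Kutta step for the invariant field commutes
with the action, and the second factor moves points along leaves. -/
theorem CombinedStep.mem_leaf (hXinv : ContDiff ℝ 1 Xinv)
    (hinv : ∀ (g : G) (x : V), Xinv (ρ g x) = ρ g (Xinv x)) {τ : ℝ} {x y x' y' : V}
    (hx : CombinedStep ρ T r A Xinv τ x x') (hy : CombinedStep ρ T r A Xinv τ y y')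
    (hxy : y ∈ leaf ρ x) : y' ∈ leaf ρ x' := by
  obtain ⟨g₁, m, hm, rfl⟩ := hx.exists_step
  obtain ⟨g₂, m', hm', rfl⟩ := hy.exists_step
  obtain ⟨g, rfl⟩ := hxy
  obtain rfl := hm'.unique hXinv (step_rep hinv hm g)
  exact ⟨g₂ * g * g₁⁻¹, by simp⟩

/-- A surjective combined step maps leaves onto leaves if the Runge-Kutta step for the invariant field
is injective: the latter then separates leaves. -/
theorem image_leaf_of_surjective (hXinv : ContDiff ℝ 1 Xinv)
    (hinv : ∀ (g : G) (x : V), Xinv (ρ g x) = ρ g (Xinv x)) {τ : ℝ} {Φ Ψ : V → V}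
    (hΦ : ∀ x, CombinedStep ρ T r A Xinv τ x (Φ x)) (hΨ : ∀ x, T.Step Xinv τ x (Ψ x))
    (hsurj : Function.Surjective Φ) (hinj : Function.Injective Ψ) (x : V) :
    Φ '' leaf ρ x = leaf ρ (Φ x) := by
  refine Set.Subset.antisymm ?_ ?_
  · rintro _ ⟨y, hy, rfl⟩
    exact (hΦ x).mem_leaf hXinv hinv (hΦ y) hy
  · rintro _ ⟨k, rfl⟩
    obtain ⟨y, hy⟩ := hsurj (ρ k (Φ x))
    refine ⟨y, ?_, hy⟩
    obtain ⟨g₁, m, hm, hgm⟩ := (hΦ x).exists_step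
    obtain ⟨g₂, m', hm', hgm'⟩ := (hΦ y).exists_step
    obtain rfl := hm.unique hXinv (hΨ x)
    obtain rfl := hm'.unique hXinv (hΨ y)
    -- the two Runge-Kutta results lie on one leaf, which determines the leaf of `y` by injectivity
    have h1 : Ψ y = ρ (g₂⁻¹ * k * g₁) (Ψ x) := by
      rw [← ρ.inv_self_apply g₂ (Ψ y), ← hgm', hy, hgm]
      simp
    have h2 : Ψ (ρ (g₂⁻¹ * k * g₁) x) = Ψ y := by
      rw [h1]
      exact (hΨ _).unique hXinv (step_rep hinv (hΨ x) _)
    exact ⟨_, hinj h2⟩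

end Leaves

end

theorem mainTheorem6
    {E : Type*} [NormedAddCommGroup E] [NormedSpace ℝ E] [FiniteDimensional ℝ E]
    {G : Type*} [TopologicalSpace G] [ChartedSpace E G] [Group G] [LieGroup 𝓘(ℝ, E) ∞ G]
    [T2Space G]
    {n : ℕ}
    -- a smooth linear action of the Lie group `G` on `ℝ ^ n`
    (ρ : Representation ℝ G (EuclideanSpace ℝ (Fin n)))
    (hρ : ContMDiff (𝓘(ℝ, E).prod 𝓘(ℝ, EuclideanSpace ℝ (Fin n))) 𝓘(ℝ, EuclideanSpace ℝ (Fin n)) ∞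
      (fun q : G × EuclideanSpace ℝ (Fin n) => ρ q.1 q.2))
    -- a smooth vector field tangent to the leaves and a smooth invariant one
    (Xtan Xinv : EuclideanSpace ℝ (Fin n) → EuclideanSpace ℝ (Fin n))
    (hXtan : ContDiff ℝ ∞ Xtan) (hXinv : ContDiff ℝ ∞ Xinv)
    (htan : IsTangentToLeaves (E := E) ρ Xtan)
    (hinv : ∀ (g : G) (x : EuclideanSpace ℝ (Fin n)), Xinv (ρ g x) = ρ g (Xinv x))
    -- the chosen smooth differential equation `ġ = A(g, m) g` on `G`
    (A : G → EuclideanSpace ℝ (Fin n) → GroupLieAlgebra 𝓘(ℝ, E) G)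
    (hA : ContMDiff (M' := E) (𝓘(ℝ, E).prod 𝓘(ℝ, EuclideanSpace ℝ (Fin n))) 𝓘(ℝ, E) ∞
      (fun q : G × EuclideanSpace ℝ (Fin n) => A q.1 q.2))
    (hAtan : ∀ (g : G) (m : EuclideanSpace ℝ (Fin n)),
      actionDeriv (E := E) ρ g m (rightTranslate (A g m) g) = Xtan (ρ g m))
    -- a Runge-Kutta method of order `p`, and the truncation index of the Munthe-Kaas method
    (p s : ℕ) (T : ButcherTableau s) (hT : T.HasOrder p)
    (r : ℕ∞) (hr : (p : ℕ∞) ≤ r + 2) :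
    -- order `p`
    IsIntegratorOfOrder p (CombinedStep ρ T r A Xinv) (fun x => Xtan x + Xinv x) ∧
    -- foliate: points of one leaf are mapped to points of one leaf
    (∀ (τ : ℝ) (x y x' y' : EuclideanSpace ℝ (Fin n)),
      CombinedStep ρ T r A Xinv τ x x' → CombinedStep ρ T r A Xinv τ y y' →
      y ∈ leaf ρ x → y' ∈ leaf ρ x') ∧
    -- where the time steps are globally defined bijections, leaves are mapped onto leaves
    (∀ (τ : ℝ) (Φ Ψ : EuclideanSpace ℝ (Fin n) → EuclideanSpace ℝ (Fin n)),
      (∀ x, CombinedStep ρ T r A Xinv τ x (Φ x)) → (∀ x, T.Step Xinv τ x (Ψ x)) →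
      Function.Surjective Φ → Function.Injective Ψ →
      ∀ x, Φ '' leaf ρ x = leaf ρ (Φ x)) := by
  have : CompleteSpace E := FiniteDimensional.complete ℝ E
  have hR := contMDiff_repCLM hρ
  have hRd : MDifferentiable 𝓘(ℝ, E) 𝓘(ℝ, _) (repCLM ρ) := hR.mdifferentiable (by simp)
  have hX1 : ContDiff ℝ 1 Xinv := contDiff_infty.1 hXinv 1
  refine ⟨?_, fun τ x y x' y' hx hy hxy => hx.mem_leaf hX1 hinv hy hxy,
    fun τ Φ Ψ hΦ hΨ hsurj hinj x => image_leaf_of_surjective hX1 hinv hΦ hΨ hsurj hinj x⟩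
  rw [combinedStep_eq_algebraStep hRd]
  obtain ⟨ε, hε, hexp⟩ := exists_contMDiffOn_lieExp (E := E) (G := G)
  have hact : ∀ (u : E) (m : EuclideanSpace ℝ (Fin n)),
      NormedSpace.exp (repDeriv E ρ u) m = ρ (lieExp (E := E) u) m := fun u m =>
    (DFunLike.congr_fun (repCLM_lieExp hRd u) m).symm
  refine isIntegratorOfOrder_algebraStep (adCLM_self (G := G)) (repDeriv_modelBracket hR) hε ?_
    hXtan hXinv hT hr (fun u m => ?_) (fun u m => ?_)
  · have h1 : ContMDiffOn 𝓘(ℝ, E × EuclideanSpace ℝ (Fin n)) 𝓘(ℝ, E) ∞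
        (fun q : E × EuclideanSpace ℝ (Fin n) => lieExp (E := E) (G := G) q.1)
        (Metric.ball 0 ε ×ˢ Set.univ) :=
      hexp.comp contDiff_fst.contMDiff.contMDiffOn fun q hq => hq.1
    exact contMDiffOn_iff_contDiffOn.1
      (hA.comp_contMDiffOn (h1.prodMk contDiff_snd.contMDiff.contMDiffOn))
  · rw [hact]
    exact (actionDeriv_rightTranslate hRd _ m _).symm.trans (hAtan _ m)
  · rw [hact, hact]
    exact hinv _ m
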